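/- **Setting.** The Lorenz template is a branched surface in $\mathbb R^3$. Its branch line is a segment $[-p,q]$ ($p,q>0$) of a horizontal real line. Its left ear is a strip leaving the branch line along $[-p,0]$ and returning to it along all of $[-p,q]$; its right ear leaves along $[0,q]$ and also returns along all of $[-p,q]$. Both ears are untwisted, and strands of the left ear cross over strands of the right ear. A modular link $L$ is a finite union of disjoint simple closed curves in the template following the direction of the ears; its turns (arcs between consecutive visits to the branch line) start at negative points in the left ear (letter $x$) or at positive points in the right ear (letter $y$). Reading letters along the $r$-th component gives its word; write the words of all components as $$w_r=x_{i_r+1}^{k_{i_r+1}}y_{i_r+1}^{l_{i_r+1}}\cdots x_{i_r+n_r}^{k_{i_r+n_r}}y_{i_r+n_r}^{l_{i_r+n_r}},\qquad i_r=n_1+\dots+n_{r-1},\quad n_r\ge 1,\ k_i,l_i\ge1,$$ where the labels $1,\dots,\overline n$, $\overline n=\sum_r n_r$, distinguish the bases and $i\mapsto i+1$ is taken cyclically inside each word. The words are primitive and lie in pairwise distinct cyclic permutation classes. Let $k_\mu=\max_i k_i$ and $l_\lambda=\max_i l_i$, and assume $p\ge k_\mu+0.4$, $q\ge l_\lambda+0.4$.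 The $j$-th turn of the subword $x_i^{k_i}$ is called the $(x_i,j)$-turn, and similarly for $y_i$. The order within the full $x$-bunch of $L$ is the tuple $(x_{\sigma(1)},\dots,x_{\sigma(\overline n)})$ such that the $\overline n$ rightmost $x$-turns are, from left to right, the $(x_{\sigma(s)},k_{\sigma(s)})$-turns; the order within the full $y$-bunch is the tuple $(y_{\tau(1)},\dots,y_{\tau(\overline n)})$ such that the $\overline n$ leftmost $y$-turns are, from left to right, the $(y_{\tau(s)},l_{\tau(s)})$-turns. **Theorem (bunch algorithm).** Given the labelled words, the following steps can be carried out and draw $L$ in the template. 1. Mark the branch line with the integers $-k_\mu,\dots,+l_\lambda$. 2. Order the $x$-bases by ascending $l_i$; order those with equal $l_i$ by descending $k_{i+1}$; those still tied by ascending $l_{i+1}$; then by descending $k_{i+2}$; and so on. Order the $y$-bases by descending $k_{i+1}$, ties by ascending $l_{i+1}$, then by descending $k_{i+2}$, and so on. After finitely many steps this gives unique total orders $(x_{\sigma(1)},\dots,x_{\sigma(\overline n)})$ and $(y_{\tau(1)},\dots,y_{\tau(\overline n)})$, and these are the orders within the full $x$-bunch and the full $y$-bunch of $L$. In each interval $(-v-0.4,-v+0.4)$,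 $1\le v\le k_\mu$, draw $\overline n$ points labelled $x_{\sigma(1)},\dots,x_{\sigma(\overline n)}$ from left to right; in each interval $(v-0.4,v+0.4)$, $1\le v\le l_\lambda$, draw $\overline n$ points labelled $y_{\tau(1)},\dots,y_{\tau(\overline n)}$ from left to right. 3. For each component and each label $i$ of its word, draw the $x_i^{k_i}$-arc from the $x_i$-point in the $-k_i$-th interval, through the $x_i$-points in the intervals $-k_i+1,\dots,-1$, to the $y_i$-point in the $+l_i$-th interval; and draw the $y_i^{l_i}$-arc from the $y_i$-point in the $+l_i$-th interval, through the $y_i$-points in the intervals $l_i-1,\dots,1$, to the $x_{i+1}$-point in the $-k_{i+1}$-th interval. For every choice of points in step 2, step 3 can be carried out with straight strands, and gives disjoint simple closed curves in the template, with the given words. However step 3 is carried out with disjoint simple closed curves in the template, the drawn link is ambient isotopic to $L$: for every open neighbourhood $U$ of the template there is an ambient isotopy of $\mathbb R^3$, fixed outside $U$ and keeping the moving link in the template, that carries each turn of $L$ to the equally labelled turn of the drawing, preserving directions. -/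

import Mathlib

/-! ### Labelled code words -/

/-- The two letters of a code word. -/
inductive Letter
  | x
  | y

/-- The labelled code words of a modular link with `c` components. The word of the component `r` is
`x₁^{k₁} y₁^{l₁} ⋯ xₙ^{kₙ} yₙ^{lₙ}` with `n = period r ≥ 1` and positive exponents `kᵢ = xExp r i`,
`lᵢ = yExp r i`; every word is primitive (aperiodic), and different components have words in
different cyclic permutation classes. -/
structure CodeWords (c : ℕ) where
  period : Fin c → ℕ
  period_pos : ∀ r, 0 < period r
  xExp : (r : Fin c) → Fin (period r) → ℕ
  yExp : (r : Fin c) → Fin (period r) → ℕ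
  xExp_pos : ∀ r i, 0 < xExp r i
  yExp_pos : ∀ r i, 0 < yExp r i
  /-- A word is not a proper power. -/
  primitive : ∀ (r : Fin c) (v : List Letter) (m : ℕ),
    (List.ofFn fun i => List.replicate (xExp r i) Letter.x ++
      List.replicate (yExp r i) Letter.y).flatten = (List.replicate m v).flatten → m = 1
  /-- Words of different components are not cyclic permutations of each other. -/
  distinct : ∀ r r' : Fin c, r ≠ r' →
    ¬ List.IsRotated
      (List.ofFn fun i => List.replicate (xExp r i) Letter.x ++
        List.replicate (yExp r i) Letter.y).flatten
      (List.ofFn fun i => List.replicate (xExp r' i) Letter.x ++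
        List.replicate (yExp r' i) Letter.y).flatten

namespace CodeWords

variable {c : ℕ} (W : CodeWords c)

/-- The labels (subscripts) of the bases: a component and a subscript in its word. The label `i`
is shared by the `x`-base `xᵢ` and the `y`-base `yᵢ`. -/
abbrev Base : Type := Σ r : Fin c, Fin (W.period r)

/-- The exponent `kᵢ` of the base `xᵢ`. -/
def k (i : W.Base) : ℕ := W.xExp i.1 i.2

/-- The exponent `lᵢ` of the base `yᵢ`. -/
def l (i : W.Base) : ℕ := W.yExp i.1 i.2

/-- The cyclic successor `i + 1` of a subscript inside its own word. -/
def succ (i : W.Base) : W.Base := ⟨i.1, finRotate (W.period i.1) i.2⟩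

/-- The sum `n̄` of all word periods. -/
def nbar : ℕ := ∑ r, W.period r

/-- A maximal `x`-exponent among all words. -/
def kMax : ℕ := Finset.univ.sup W.k

/-- A maximal `y`-exponent among all words. -/
def lMax : ℕ := Finset.univ.sup W.l

/-- The letters of the words, equivalently the turns of the link. With `j` counted from `0`,
`Turn.x i j` is the `(xᵢ, j+1)`-turn and `Turn.y i j` is the `(yᵢ, j+1)`-turn. -/
inductive Turn
  | x (i : W.Base) (j : Fin (W.k i))
  | y (i : W.Base) (j : Fin (W.l i))

variable {W}

/-- The letter that a turn carries. -/
def Turn.letter : W.Turn → Letter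
  | .x _ _ => Letter.x
  | .y _ _ => Letter.y

/-- The turn that follows a given turn, reading the word cyclically. -/
def Turn.next : W.Turn → W.Turn
  | .x i j =>
      if h : j.1 + 1 < W.k i then .x i ⟨j.1 + 1, h⟩ else .y i ⟨0, W.yExp_pos i.1 i.2⟩
  | .y i j =>
      if h : j.1 + 1 < W.l i then .y i ⟨j.1 + 1, h⟩
      else .x (W.succ i) ⟨0, W.xExp_pos (W.succ i).1 (W.succ i).2⟩

variable (W)

/-- The last turn of the `xᵢ^{kᵢ}`-arc, i.e. the `(xᵢ, kᵢ)`-turn. -/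
def lastX (i : W.Base) : W.Turn :=
  .x i ⟨W.k i - 1, Nat.sub_lt (W.xExp_pos i.1 i.2) Nat.one_pos⟩

/-- The last turn of the `yᵢ^{lᵢ}`-arc, i.e. the `(yᵢ, lᵢ)`-turn. -/
def lastY (i : W.Base) : W.Turn :=
  .y i ⟨W.l i - 1, Nat.sub_lt (W.yExp_pos i.1 i.2) Nat.one_pos⟩

/-! ### The recursive ordering procedure for the full bunches -/

/-- `xᵢ` is put before `xⱼ` by the procedure: order by ascending `lᵢ`; for ties, by descending
`k_{i+1}`; for ties, by ascending `l_{i+1}`; for ties, by descending `k_{i+2}`; and so on,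
finitely many times. -/
inductive XBefore : W.Base → W.Base → Prop
  | ascending_l {i j : W.Base} : W.l i < W.l j → XBefore i j
  | descending_k {i j : W.Base} : W.l i = W.l j → W.k (W.succ j) < W.k (W.succ i) → XBefore i j
  | continue {i j : W.Base} : W.l i = W.l j → W.k (W.succ i) = W.k (W.succ j) →
      XBefore (W.succ i) (W.succ j) → XBefore i j

/-- `yᵢ` is put before `yⱼ` by the procedure: order by descending `k_{i+1}`; for ties, by ascending
`l_{i+1}`; for ties, by descending `k_{i+2}`; and so on, finitely many times. -/
inductive YBefore : W.Base → W.Base → Prop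
  | descending_k {i j : W.Base} : W.k (W.succ j) < W.k (W.succ i) → YBefore i j
  | ascending_l {i j : W.Base} : W.k (W.succ i) = W.k (W.succ j) →
      W.l (W.succ i) < W.l (W.succ j) → YBefore i j
  | continue {i j : W.Base} : W.k (W.succ i) = W.k (W.succ j) →
      W.l (W.succ i) = W.l (W.succ j) → YBefore (W.succ i) (W.succ j) → YBefore i j

/-- `(x_{σ(1)}, …, x_{σ(n̄)})` lists all `x`-bases in the order found by the procedure. -/
def IsXOrder (σ : Fin W.nbar ≃ W.Base) : Prop := ∀ s t, s < t → W.XBefore (σ s) (σ t)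

/-- `(y_{τ(1)}, …, y_{τ(n̄)})` lists all `y`-bases in the order found by the procedure. -/
def IsYOrder (τ : Fin W.nbar ≃ W.Base) : Prop := ∀ s t, s < t → W.YBefore (τ s) (τ t)

end CodeWords

/-! ### The Lorenz template in three-space

The branch line is the segment `[-p, q] × {(1, 0)}`, part of a horizontal real line. The left ear
is a strip that leaves the branch line along its left half `[-p, 0]` (the `x`-split line) and comes
back to it along its whole length; the right ear leaves it along `[0, q]` (the `y`-split line) and
also comes back along its whole length. The time `t ∈ [0, 1]` runs along the strips, and the
horizontal cross-section at time `t` is `[-p, t q]` in the left and `[-t p, q]` in the right ear.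

First coordinate: to the right; second: upwards; third: towards the viewer. Each ear winds once
around the first axis (untwisted), running downwards in front and back upwards behind, with the
left ear outside the right ear. So seen by the viewer the strands of the left ear run from left to
right and cross over the strands of the right ear. Cut along the branch line this is the split
template, and glueing its split lines to the branch line behind the picture, instead of by arcs to
the left and to the right of it, gives an ambient isotopic branched surface (the usual passage
from the template to closures of Lorenz braids). -/

/-- Three-space; only its topology is used. -/
abbrev Space : Type := ℝ × ℝ × ℝ

/-- The point with horizontal coordinate `h` at time `t` of the left ear (letter `x`) or the right
ear (letter `y`). -/
noncomputable def earPoint : Letter → ℝ → ℝ → Space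
  | .x, h, t => (h, (1 + t * (1 - t)) * Real.cos (2 * Real.pi * t),
      (1 + t * (1 - t)) * Real.sin (2 * Real.pi * t))
  | .y, h, t => (h, (1 - t * (1 - t)) * Real.cos (2 * Real.pi * t),
      (1 - t * (1 - t)) * Real.sin (2 * Real.pi * t))

/-- The horizontal cross-section at time `t` of an ear. -/
def earSection (p q : ℝ) : Letter → ℝ → Set ℝ
  | .x, t => Set.Icc (-p) (t * q)
  | .y, t => Set.Icc (-(t * p)) q

/-- The Lorenz template with branch line `[-p, q]`. -/
def LorenzTemplate (p q : ℝ) : Set Space :=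
  {z | ∃ (e : Letter) (h t : ℝ), t ∈ Set.Icc (0 : ℝ) 1 ∧ h ∈ earSection p q e t ∧
    z = earPoint e h t}

/-! ### Modular links in the template -/

/-- A modular link with labelled code words `W`, embedded in the Lorenz template: disjoint simple
closed curves, each of them the concatenation, in the cyclic order of its word, of turns. A turn
for the letter `x` starts at a negative point of the branch line and follows the left ear back to
the branch line; a turn for the letter `y` starts at a positive point of the branch line and
follows the right ear. Turns follow the direction of the ears, and so are parametrised by time. -/
structure TemplateLink {c : ℕ} (W : CodeWords c) (p q : ℝ) where
  /-- Horizontal coordinate of a turn at time `t ∈ [0, 1]`. -/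
  pos : W.Turn → ℝ → ℝ
  continuousOn_pos : ∀ u, ContinuousOn (pos u) (Set.Icc 0 1)
  pos_mem : ∀ u, ∀ t ∈ Set.Icc (0 : ℝ) 1, pos u t ∈ earSection p q u.letter t
  /-- A turn ends where the next one starts. -/
  pos_one : ∀ u, pos u 1 = pos u.next 0
  neg_start : ∀ i j, pos (.x i j) 0 < 0
  pos_start : ∀ i j, 0 < pos (.y i j) 0
  /-- The curves are simple and pairwise disjoint. -/
  injOn : Set.InjOn (fun z : W.Turn × ℝ => earPoint z.1.letter (pos z.1 z.2) z.2)
    (Set.univ ×ˢ Set.Ico (0 : ℝ) 1)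

namespace TemplateLink

variable {c : ℕ} {W : CodeWords c} {p q : ℝ}

/-- The turns as curves in space. -/
noncomputable def curve (L : TemplateLink W p q) (u : W.Turn) (t : ℝ) : Space :=
  earPoint u.letter (L.pos u t) t

/-- `(x_{σ(1)}, …, x_{σ(n̄)})` is the order within the full `x`-bunch of `L`: the `n̄` rightmost
`x`-turns are, from left to right, the `(x_{σ(s)}, k_{σ(s)})`-turns. -/
def IsFullXBunchOrder (L : TemplateLink W p q) (σ : Fin W.nbar ≃ W.Base) : Prop :=
  (∀ s t, s < t → L.pos (W.lastX (σ s)) 0 < L.pos (W.lastX (σ t)) 0) ∧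
  ∀ i j, (∀ s, CodeWords.Turn.x i j ≠ W.lastX (σ s)) →
    ∀ s, L.pos (.x i j) 0 < L.pos (W.lastX (σ s)) 0

/-- `(y_{τ(1)}, …, y_{τ(n̄)})` is the order within the full `y`-bunch of `L`: the `n̄` leftmost
`y`-turns are, from left to right, the `(y_{τ(s)}, l_{τ(s)})`-turns. -/
def IsFullYBunchOrder (L : TemplateLink W p q) (τ : Fin W.nbar ≃ W.Base) : Prop :=
  (∀ s t, s < t → L.pos (W.lastY (τ s)) 0 < L.pos (W.lastY (τ t)) 0) ∧
  ∀ i j, (∀ s, CodeWords.Turn.y i j ≠ W.lastY (τ s)) →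
    ∀ s, L.pos (W.lastY (τ s)) 0 < L.pos (.y i j) 0

/-- `L` and `D` are ambient isotopic in the template: for every open neighbourhood `U` of the
template there is an ambient isotopy of three-space that fixes every point outside `U` (so it takes
place in the complement of any closed set disjoint from the template, such as the trefoil), keeps
the moving link in the template, and carries every turn of `L` to the turn of `D` with the same
label, respecting the direction. -/
def AmbientIsotopic (L D : TemplateLink W p q) : Prop :=
  ∀ U : Set Space, IsOpen U → LorenzTemplate p q ⊆ U →
    ∃ H : unitInterval → (Space ≃ₜ Space),
      Continuous (fun z : unitInterval × Space => H z.1 z.2) ∧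
      (∀ z, H 0 z = z) ∧
      (∀ s, ∀ z ∉ U, H s z = z) ∧
      (∀ s u, ∀ t ∈ Set.Icc (0 : ℝ) 1, H s (L.curve u t) ∈ LorenzTemplate p q) ∧
      ∀ u, ∀ t ∈ Set.Icc (0 : ℝ) 1, H 1 (L.curve u t) = D.curve u t

end TemplateLink

/-! ### The drawing steps of the bunch algorithm -/

/-- The points drawn on the branch line, listed from left to right: `n̄` points in each of the
intervals `(-v - 0.4, -v + 0.4)`, `1 ≤ v ≤ k_μ`, and `n̄` points in each of the intervals
`(v - 0.4, v + 0.4)`, `1 ≤ v ≤ l_λ`. -/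
structure CodeWords.Marking {c : ℕ} (W : CodeWords c) where
  negPoint : ℕ → Fin W.nbar → ℝ
  posPoint : ℕ → Fin W.nbar → ℝ
  negPoint_mem : ∀ v ∈ Set.Icc 1 W.kMax, ∀ s,
    negPoint v s ∈ Set.Ioo (-(v : ℝ) - 2 / 5) (-(v : ℝ) + 2 / 5)
  posPoint_mem : ∀ v ∈ Set.Icc 1 W.lMax, ∀ s,
    posPoint v s ∈ Set.Ioo ((v : ℝ) - 2 / 5) ((v : ℝ) + 2 / 5)
  negPoint_strictMono : ∀ v ∈ Set.Icc 1 W.kMax, StrictMono (negPoint v)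
  posPoint_strictMono : ∀ v ∈ Set.Icc 1 W.lMax, StrictMono (posPoint v)

/-- `D` is drawn from the marked points, where the points of each negative interval are labelled
`x_{σ(1)}, …, x_{σ(n̄)}` and those of each positive interval `y_{τ(1)}, …, y_{τ(n̄)}`, from left to
right: the `xᵢ^{kᵢ}`-arc starts at the `xᵢ`-point in the `-kᵢ`-th interval and passes through
the `xᵢ`-points in the intervals `-kᵢ + 1, …, -1`; the `yᵢ^{lᵢ}`-arc starts at the `yᵢ`-point in the
`+lᵢ`-th interval and passes through the `yᵢ`-points in the intervals `lᵢ - 1, …, 1`. (As each arc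
ends where the next one starts, the former ends at the `yᵢ`-point in the `+lᵢ`-th interval and
the latter at the `x_{i+1}`-point in the `-k_{i+1}`-th interval.) -/
def TemplateLink.IsDrawnFrom {c : ℕ} {W : CodeWords c} {p q : ℝ} (D : TemplateLink W p q)
    (P : W.Marking) (σ τ : Fin W.nbar ≃ W.Base) : Prop :=
  (∀ i (j : Fin (W.k i)), D.pos (.x i j) 0 = P.negPoint (W.k i - j) (σ.symm i)) ∧
  ∀ i (j : Fin (W.l i)), D.pos (.y i j) 0 = P.posPoint (W.l i - j) (τ.symm i)

/-- Every turn is drawn as a straight strand: the horizontal coordinate moves linearly. -/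
def TemplateLink.IsStraight {c : ℕ} {W : CodeWords c} {p q : ℝ} (D : TemplateLink W p q) : Prop :=
  ∀ u, ∀ t ∈ Set.Icc (0 : ℝ) 1, D.pos u t = (1 - t) * D.pos u 0 + t * D.pos u.next 0

/-!
The order in which the turns of a modular link start on the branch line is forced by its words.
Strands of one ear cannot cross (`TemplateLink.pos_lt_pos`), so two turns of the same letter start
in the order in which they end, that is, in which the next two turns start; and `x`-turns start to
the left of `y`-turns. Following two arcs until they part, this is exactly the comparison of
exponents made by the ordering procedure (`TemplateLink.pos_lt_pos_of_before`), where
`CodeWords.Turn.Before` is the resulting explicit order on the turns. The procedure decides every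
pair of bases because two bases from which the same exponents are read forever would make a word
periodic, or two words cyclic permutations of each other (`CodeWords.base_ext_of_iterate`). So it
defines strict total orders on the bases, and these can be listed in just one way.

Conversely, the marked points lie in the order `CodeWords.Turn.Before`, and an ear preserves this
order (`CodeWords.Turn.Before.next`). Hence straight strands between them do not cross, which gives
the drawing `CodeWords.Marking.straightLink`.

Any two links `L`, `D` with the same labelled words are ambient isotopic, because their strands lie
in the same order over each point `w` of the plane orthogonal to the branch line. The isotopy moves
points horizontally, by `h ↦ (1 - s) h + s f_w(h)`, where `f_w` is an increasing function that
carries the points of `L` over `w` to those of `D` and moves nothing outside the given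
neighbourhood. These conditions on `f_w` are convex, so it is enough to choose `f_w` continuously
near each `w` and to glue by a partition of unity (`TemplateLink.exists_continuous_fiberMaps`).
Locally, `f_w` is a piecewise linear interpolation between finitely many strands, regarded as
functions of the angle of `w` around the axis of the ears; near the branch line each turn is
joined to the next one (`TemplateLink.crossing`).
-/

/-! ### Periodic sequences of blocks -/

theorem Function.Periodic.int_gcd {β : Type*} {S : ℤ → β} {a b : ℤ}
    (ha : Function.Periodic S a) (hb : Function.Periodic S b) :
    Function.Periodic S (Int.gcd a b : ℤ) := by
  rw [Int.gcd_eq_gcd_ab]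
  have h1 := ha.int_mul (Int.gcdA a b)
  have h2 := hb.int_mul (Int.gcdB a b)
  rw [mul_comm a, mul_comm b]
  exact h1.add_period h2

/-- The concatenation of the first `n` terms of a sequence of lists. -/
def blockWord {α : Type*} (S : ℤ → List α) (n : ℕ) : List α :=
  ((List.range n).map fun m : ℕ => S m).flatten

theorem blockWord_mul {α : Type*} {S : ℤ → List α} {g : ℕ} (hS : Function.Periodic S (g : ℤ))
    (m : ℕ) : blockWord S (m * g) = (List.replicate m (blockWord S g)).flatten := by
  induction m with
  | zero => simp [blockWord]
  | succ m ih =>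
    rw [Nat.succ_mul, List.replicate_succ', List.flatten_append, ← ih]
    have h : ∀ j : ℕ, S (((m * g + j : ℕ) : ℤ)) = S j := fun j => by
      have := (hS.nat_mul m) (j : ℤ)
      rw [← this]; congr 1; push_cast; ring
    simp only [blockWord, List.range_add, List.map_append, List.map_map, Function.comp_def, h,
      List.flatten_append, List.flatten_singleton]

theorem blockWord_shift_one_isRotated {α : Type*} {S : ℤ → List α} {n : ℕ}
    (hS : Function.Periodic S (n : ℤ)) :
    List.IsRotated (blockWord (fun m => S (m + 1)) n) (blockWord S n) := by
  cases n with
  | zero => simp [blockWord]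
  | succ n =>
    have h1 : blockWord (fun m => S (m + 1)) (n + 1) =
        blockWord (fun m => S (m + 1)) n ++ S 0 := by
      have := hS 0
      simp only [zero_add, Nat.cast_add, Nat.cast_one] at this
      simp [blockWord, List.range_succ, this]
    have h2 : blockWord S (n + 1) = S 0 ++ blockWord (fun m => S (m + 1)) n := by
      simp [blockWord, List.range_succ_eq_map, Function.comp_def]
    rw [h1, h2]
    exact List.isRotated_append

theorem blockWord_shift_isRotated {α : Type*} {S : ℤ → List α} {n : ℕ}
    (hS : Function.Periodic S (n : ℤ)) (d : ℤ) :
    List.IsRotated (blockWord (fun m => S (m + d)) n) (blockWord S n) := by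
  have hper : ∀ d : ℤ, Function.Periodic (fun m => S (m + d)) (n : ℤ) := fun d m => by
    have := hS (m + d)
    simp only
    rw [← this]; congr 1; ring
  have step : ∀ d : ℤ, List.IsRotated (blockWord (fun m => S (m + (d + 1))) n)
      (blockWord (fun m => S (m + d)) n) := fun d => by
    have := blockWord_shift_one_isRotated (hper d)
    simpa only [add_assoc, add_comm (1 : ℤ)] using this
  induction d using Int.induction_on with
  | zero => simp only [add_zero]; exact List.IsRotated.refl _
  | succ d ih => exact (step _).trans ih
  | pred d ih =>
    have := step (-(d : ℤ) - 1)
    rw [sub_add_cancel] at this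
    exact this.symm.trans ih

namespace CodeWords

/-! ### Primitivity of the words -/

variable {c : ℕ} (W : CodeWords c)

/-- The word of a component, as it occurs in the definition of `CodeWords`. -/
def word (r : Fin c) : List Letter :=
  (List.ofFn fun i => List.replicate (W.xExp r i) Letter.x ++
      List.replicate (W.yExp r i) Letter.y).flatten

/-- The block `xᵢ^{kᵢ} yᵢ^{lᵢ}`. -/
def block (i : W.Base) : List Letter :=
  List.replicate (W.k i) Letter.x ++ List.replicate (W.l i) Letter.y

/-- The base of the component `r` with subscript `m`, read modulo the period. -/
def baseAt (r : Fin c) (m : ℤ) : W.Base :=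
  ⟨r, ⟨(m % (W.period r : ℤ)).toNat, by
    have h : (0 : ℤ) < W.period r := by exact_mod_cast W.period_pos r
    have h1 := Int.emod_nonneg m h.ne'
    have h2 := Int.emod_lt_of_pos m h
    omega⟩⟩

theorem baseAt_val (i : W.Base) : W.baseAt i.1 (i.2 : ℕ) = i := by
  rcases i with ⟨r, a⟩
  have : ((a : ℕ) : ℤ) % (W.period r : ℤ) = (a : ℕ) :=
    Int.emod_eq_of_lt (by positivity) (by exact_mod_cast a.2)
  simp [baseAt, this]

theorem baseAt_periodic (r : Fin c) : Function.Periodic (W.baseAt r) (W.period r : ℤ) := by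
  intro m
  simp [baseAt]

theorem succ_baseAt (r : Fin c) (m : ℤ) : W.succ (W.baseAt r m) = W.baseAt r (m + 1) := by
  have key : ∀ (n : ℕ) (a : Fin n), ((finRotate n a : Fin n) : ℕ) = (a + 1) % n := by
    intro n a
    cases n with
    | zero => exact a.elim0
    | succ n => simp [finRotate_apply, Fin.val_add]
  have h : (0 : ℤ) < W.period r := by exact_mod_cast W.period_pos r
  have h1 := Int.emod_nonneg m h.ne'
  unfold succ baseAt
  congr 1
  apply Fin.ext
  rw [key]
  zify
  rw [Int.toNat_of_nonneg h1, Int.toNat_of_nonneg (Int.emod_nonneg _ h.ne')]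
  simp

theorem succ_iterate (i : W.Base) (m : ℕ) : W.succ^[m] i = W.baseAt i.1 ((i.2 : ℕ) + (m : ℤ)) := by
  induction m with
  | zero => simp [baseAt_val]
  | succ m ih => rw [Function.iterate_succ_apply', ih, succ_baseAt]; push_cast; rw [add_assoc]

theorem word_eq_blockWord (r : Fin c) :
    W.word r = blockWord (fun m => W.block (W.baseAt r m)) (W.period r) := by
  unfold word blockWord
  congr 1
  refine List.ext_getElem (by simp) fun m h1 h2 => ?_
  simp only [List.length_ofFn] at h1
  have := W.baseAt_val ⟨r, ⟨m, h1⟩⟩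
  simp only at this
  simp only [List.getElem_ofFn, List.getElem_map, List.getElem_range, this]
  rfl

/-- Primitivity of a word, expressed by its sequence of blocks: every period is a multiple of the
word period. -/
theorem period_dvd_of_periodic (r : Fin c) (d : ℤ)
    (hd : Function.Periodic (fun m => W.block (W.baseAt r m)) d) : (W.period r : ℤ) ∣ d := by
  have hn : Function.Periodic (fun m => W.block (W.baseAt r m)) (W.period r : ℤ) :=
    (W.baseAt_periodic r).comp W.block
  obtain ⟨m, hm⟩ : Int.gcd (W.period r) d ∣ W.period r := by
    exact_mod_cast Int.gcd_dvd_left (a := (W.period r : ℤ)) (b := d)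
  -- The greatest common divisor of both periods is a period, so the word is an `m`-th power.
  have hw := W.word_eq_blockWord r
  rw [show W.period r = m * Int.gcd (W.period r) d from hm.trans (mul_comm _ _),
    blockWord_mul (hn.int_gcd hd)] at hw
  have h1 := W.primitive r _ m hw
  rw [h1, mul_one] at hm
  rw [hm]
  exact Int.gcd_dvd_right ..

/-- Two labels with the same exponents all along their words coincide. The two block sequences
agree up to a shift, so each of the two periods is a period of both, and the periods are equal by
primitivity. Within one component the shift is then a period itself; for two components the words
would be cyclic permutations of each other. -/
theorem base_ext_of_iterate {i j : W.Base} (hk : ∀ m, W.k (W.succ^[m] i) = W.k (W.succ^[m] j))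
    (hl : ∀ m, W.l (W.succ^[m] i) = W.l (W.succ^[m] j)) : i = j := by
  have hb : ∀ m : ℕ, W.block (W.baseAt i.1 ((i.2 : ℕ) + (m : ℤ))) =
      W.block (W.baseAt j.1 ((j.2 : ℕ) + (m : ℤ))) := fun m => by
    rw [← succ_iterate, ← succ_iterate, block, block, hk, hl]
  have hi : Function.Periodic (fun m => W.block (W.baseAt i.1 m)) (W.period i.1 : ℤ) :=
    (W.baseAt_periodic i.1).comp W.block
  have hj : Function.Periodic (fun m => W.block (W.baseAt j.1 m)) (W.period j.1 : ℤ) :=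
    (W.baseAt_periodic j.1).comp W.block
  -- By periodicity the agreement extends to all integer shifts.
  have hs : ∀ m : ℤ, W.block (W.baseAt i.1 m) =
      W.block (W.baseAt j.1 (m + ((j.2 : ℕ) - (i.2 : ℕ) : ℤ))) := fun m => by
    have hpi : (0 : ℤ) < W.period i.1 := by exact_mod_cast W.period_pos i.1
    have hpj : (0 : ℤ) < W.period j.1 := by exact_mod_cast W.period_pos j.1
    set t : ℤ := m - (i.2 : ℕ) with ht
    have hN : 0 ≤ t + |t| * (W.period i.1 * W.period j.1) := by
      have : 1 ≤ (W.period i.1 * W.period j.1 : ℤ) := by nlinarith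
      nlinarith [abs_nonneg t, neg_abs_le t]
    obtain ⟨N, hN⟩ := Int.eq_ofNat_of_zero_le hN
    have h := hb N
    rw [← hN] at h
    have e1 : W.block (W.baseAt i.1 (m + |t| * W.period j.1 * W.period i.1)) = _ :=
      (hi.int_mul (|t| * W.period j.1)) m
    have e2 : W.block (W.baseAt j.1 (m + ((j.2 : ℕ) - (i.2 : ℕ) : ℤ) +
        |t| * W.period i.1 * W.period j.1)) = _ :=
      (hj.int_mul (|t| * W.period i.1)) (m + ((j.2 : ℕ) - (i.2 : ℕ) : ℤ))
    refine e1.symm.trans (Eq.trans ?_ e2)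
    convert h using 3 <;> (rw [ht]; ring)
  have hs' : ∀ m : ℤ, W.block (W.baseAt j.1 m) =
      W.block (W.baseAt i.1 (m + ((i.2 : ℕ) - (j.2 : ℕ) : ℤ))) := fun m => by
    rw [hs]; congr 2; ring
  have d1 : (W.period i.1 : ℤ) ∣ W.period j.1 := by
    apply W.period_dvd_of_periodic
    intro m
    simp only
    rw [hs, hs m, add_right_comm]
    exact hj _
  have d2 : (W.period j.1 : ℤ) ∣ W.period i.1 := by
    apply W.period_dvd_of_periodic
    intro m
    simp only
    rw [hs', hs' m, add_right_comm]
    exact hi _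
  have hn : W.period i.1 = W.period j.1 :=
    Nat.dvd_antisymm (by exact_mod_cast d1) (by exact_mod_cast d2)
  by_cases hr : i.1 = j.1
  · rcases i with ⟨r, a⟩
    rcases j with ⟨r', b⟩
    obtain rfl : r = r' := hr
    have hd : (W.period r : ℤ) ∣ ((b : ℕ) - (a : ℕ) : ℤ) :=
      W.period_dvd_of_periodic r _ fun m => (hs m).symm
    have ha := a.2
    have hb' := b.2
    have h0 : ((b : ℕ) - (a : ℕ) : ℤ) = 0 := by
      apply Int.eq_zero_of_abs_lt_dvd hd
      rw [abs_lt]; constructor <;> simp only at * <;> omega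
    have : a = b := Fin.ext (by omega)
    rw [this]
  · exfalso
    apply W.distinct i.1 j.1 hr
    change List.IsRotated (W.word i.1) (W.word j.1)
    rw [word_eq_blockWord, word_eq_blockWord, hn]
    have := blockWord_shift_isRotated hj ((j.2 : ℕ) - (i.2 : ℕ) : ℤ)
    simp only [← hs] at this
    exact this

/-! ### The ordering procedures are strict total orders -/

variable {W}

theorem XBefore.lt_or_yBefore {i j : W.Base} (h : W.XBefore i j) :
    W.l i < W.l j ∨ W.l i = W.l j ∧ W.YBefore i j := by
  induction h with
  | ascending_l h => exact .inl h
  | descending_k h1 h2 => exact .inr ⟨h1, .descending_k h2⟩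
  | _ h1 h2 _ ih =>
    rcases ih with h | ⟨h, h'⟩
    · exact .inr ⟨h1, .ascending_l h2 h⟩
    · exact .inr ⟨h1, .continue h2 h h'⟩

theorem YBefore.lt_or_xBefore {i j : W.Base} (h : W.YBefore i j) :
    W.k (W.succ j) < W.k (W.succ i) ∨
      W.k (W.succ i) = W.k (W.succ j) ∧ W.XBefore (W.succ i) (W.succ j) := by
  induction h with
  | descending_k h => exact .inl h
  | ascending_l h1 h2 => exact .inr ⟨h1, .ascending_l h2⟩
  | _ h1 h2 _ ih =>
    rcases ih with h | ⟨h, h'⟩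
    · exact .inr ⟨h1, .descending_k h2 h⟩
    · exact .inr ⟨h1, .continue h2 h h'⟩

theorem YBefore.of_xBefore {i j : W.Base} (hk : W.k (W.succ i) = W.k (W.succ j))
    (h : W.XBefore (W.succ i) (W.succ j)) : W.YBefore i j := by
  rcases h.lt_or_yBefore with h | ⟨h, h'⟩
  · exact .ascending_l hk h
  · exact .continue hk h h'

theorem XBefore.asymm {i j : W.Base} (h : W.XBefore i j) : ¬ W.XBefore j i := by
  induction h with
  | ascending_l h => intro h'; cases h' <;> omega
  | descending_k h1 h2 => intro h'; cases h' <;> omega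
  | _ h1 h2 _ ih =>
    intro h'
    cases h' with
    | ascending_l h => omega
    | descending_k h h' => omega
    | _ _ _ h => exact ih h

theorem XBefore.trans {i j m : W.Base} (h : W.XBefore i j) (h' : W.XBefore j m) :
    W.XBefore i m := by
  induction h generalizing m with
  | ascending_l h => cases h' <;> exact .ascending_l (by omega)
  | descending_k h1 h2 =>
    cases h' with
    | ascending_l h => exact .ascending_l (by omega)
    | descending_k h h' => exact .descending_k (by omega) (by omega)
    | _ h h' _ => exact .descending_k (by omega) (by omega)
  | _ h1 h2 _ ih =>
    cases h' with
    | ascending_l h => exact .ascending_l (by omega)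
    | descending_k h h' => exact .descending_k (by omega) (by omega)
    | _ h h' h'' => exact .continue (by omega) (by omega) (ih h'')

/-- The procedure for the `x`-bases decides every pair: otherwise all exponents read from the two
bases on agree. -/
theorem xBefore_or_xBefore {i j : W.Base} (hij : i ≠ j) : W.XBefore i j ∨ W.XBefore j i := by
  by_contra! hc
  have step : ∀ a b : W.Base, ¬ W.XBefore a b → ¬ W.XBefore b a →
      W.l a = W.l b ∧ W.k (W.succ a) = W.k (W.succ b) ∧
        ¬ W.XBefore (W.succ a) (W.succ b) ∧ ¬ W.XBefore (W.succ b) (W.succ a) := by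
    intro a b h1 h2
    have hl : W.l a = W.l b :=
      le_antisymm (not_lt.1 fun h => h2 (.ascending_l h)) (not_lt.1 fun h => h1 (.ascending_l h))
    have hk : W.k (W.succ a) = W.k (W.succ b) :=
      le_antisymm (not_lt.1 fun h => h1 (.descending_k hl h))
        (not_lt.1 fun h => h2 (.descending_k hl.symm h))
    exact ⟨hl, hk, fun h => h1 (.continue hl hk h), fun h => h2 (.continue hl.symm hk.symm h)⟩
  have all : ∀ m, ¬ W.XBefore (W.succ^[m] i) (W.succ^[m] j) ∧
      ¬ W.XBefore (W.succ^[m] j) (W.succ^[m] i) := by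
    intro m
    induction m with
    | zero => exact hc
    | succ m ih =>
      rw [Function.iterate_succ_apply', Function.iterate_succ_apply']
      exact (step _ _ ih.1 ih.2).2.2
  have hl : ∀ m, W.l (W.succ^[m] i) = W.l (W.succ^[m] j) := fun m =>
    (step _ _ (all m).1 (all m).2).1
  have hk : ∀ m, W.k (W.succ^[m + 1] i) = W.k (W.succ^[m + 1] j) := fun m => by
    rw [Function.iterate_succ_apply', Function.iterate_succ_apply']
    exact (step _ _ (all m).1 (all m).2).2.1
  -- The first `x`-exponent is met again after a common period of both words.
  have hN : ∀ a : W.Base, ∀ m : ℕ, W.succ^[m * W.period a.1] a = a := fun a m => by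
    have := (W.baseAt_periodic a.1).nat_mul m ((a.2 : ℕ) : ℤ)
    rw [succ_iterate]
    push_cast
    rw [this, baseAt_val]
  have hp : 0 < W.period j.1 * W.period i.1 := Nat.mul_pos (W.period_pos _) (W.period_pos _)
  refine hij (W.base_ext_of_iterate (fun m => ?_) hl)
  cases m with
  | succ m => exact hk m
  | zero =>
    have h := hk (W.period j.1 * W.period i.1 - 1)
    rw [Nat.sub_add_cancel hp, hN, mul_comm, hN] at h
    exact h

theorem succ_injective : Function.Injective W.succ := by
  rintro ⟨r, a⟩ ⟨r', b⟩ h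
  obtain rfl : r = r' := congrArg Sigma.fst h
  have h2 := eq_of_heq (Sigma.mk.inj h).2
  exact congrArg (Sigma.mk r) ((finRotate (W.period r)).injective h2)

theorem YBefore.asymm {i j : W.Base} (h : W.YBefore i j) : ¬ W.YBefore j i := by
  intro h'
  rcases h.lt_or_xBefore with h | ⟨h, hx⟩ <;> rcases h'.lt_or_xBefore with h' | ⟨h', hx'⟩
  · omega
  · omega
  · omega
  · exact hx.asymm hx'

theorem YBefore.trans {i j m : W.Base} (h : W.YBefore i j) (h' : W.YBefore j m) :
    W.YBefore i m := by
  rcases h.lt_or_xBefore with h | ⟨h, hx⟩ <;> rcases h'.lt_or_xBefore with h' | ⟨h', hx'⟩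
  · exact .descending_k (by omega)
  · exact .descending_k (by omega)
  · exact .descending_k (by omega)
  · exact .of_xBefore (by omega) (hx.trans hx')

theorem yBefore_or_yBefore {i j : W.Base} (hij : i ≠ j) : W.YBefore i j ∨ W.YBefore j i := by
  rcases lt_trichotomy (W.k (W.succ i)) (W.k (W.succ j)) with h | h | h
  · exact .inr (.descending_k h)
  · exact (xBefore_or_xBefore (succ_injective.ne hij)).imp (.of_xBefore h) (.of_xBefore h.symm)
  · exact .inl (.descending_k h)

theorem card_base : Fintype.card W.Base = W.nbar := by
  simp [nbar]

end CodeWords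

/-- The elements of a finite type with a strict total order can be listed in increasing order in
exactly one way. -/
theorem existsUnique_listing {α : Type*} [Fintype α] {n : ℕ} (hn : Fintype.card α = n)
    (R : α → α → Prop) (asymm : ∀ a b, R a b → ¬ R b a) (trans : ∀ a b c, R a b → R b c → R a c)
    (total : ∀ a b, a ≠ b → R a b ∨ R b a) :
    ∃ e : Fin n ≃ α, ∀ e' : Fin n ≃ α, (∀ s t, s < t → R (e' s) (e' t)) ↔ e' = e := by
  classical
  have : IsStrictTotalOrder α R :=
    { trichotomous := fun a b h1 h2 => by
        by_contra h
        exact (total a b h).elim h1 h2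
      irrefl := fun a h => asymm a a h h
      trans := trans }
  let := linearOrderOfSTO R
  refine ⟨(Fintype.orderIsoFinOfCardEq α hn).toEquiv, fun e' => ⟨fun h => ?_, ?_⟩⟩
  · have hm : StrictMono e' := fun s t hst => h s t hst
    have := Subsingleton.elim (hm.orderIsoOfSurjective e' e'.surjective)
      (Fintype.orderIsoFinOfCardEq α hn)
    ext s
    exact congrArg (fun f : Fin n ≃o α => f s) this
  · rintro rfl s t hst
    exact (Fintype.orderIsoFinOfCardEq α hn).strictMono hst

namespace CodeWords

/-! ### The order of the turns -/

variable {c : ℕ} {W : CodeWords c}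

/-- The order of the starting points of the turns on the branch line, read off from the words:
`x`-turns lie to the left of `y`-turns; turns of one letter are compared by the number of turns
left in their arcs, turns with equally many left by the ordering procedure. -/
def Turn.Before : W.Turn → W.Turn → Prop
  | .x i j, .x i' j' => W.k i' - j' < W.k i - j ∨ (W.k i - j = W.k i' - j' ∧ W.XBefore i i')
  | .x _ _, .y _ _ => True
  | .y _ _, .x _ _ => False
  | .y i j, .y i' j' => W.l i - j < W.l i' - j' ∨ (W.l i - j = W.l i' - j' ∧ W.YBefore i i')

theorem Turn.before_or_before {u v : W.Turn} (h : u ≠ v) : u.Before v ∨ v.Before u := by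
  rcases u with ⟨i, j⟩ | ⟨i, j⟩ <;> rcases v with ⟨i', j'⟩ | ⟨i', j'⟩
  · have h1 := j.2
    have h2 := j'.2
    rcases lt_trichotomy (W.k i - j) (W.k i' - j') with hr | hr | hr
    · exact .inr (.inl hr)
    · by_cases hi : i = i'
      · subst hi
        exact absurd (congrArg (Turn.x i) (Fin.ext (by omega))) h
      · exact (xBefore_or_xBefore hi).imp (fun h => .inr ⟨hr, h⟩) fun h => .inr ⟨hr.symm, h⟩
    · exact .inl (.inl hr)
  · exact .inl trivial
  · exact .inr trivial
  · have h1 := j.2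
    have h2 := j'.2
    rcases lt_trichotomy (W.l i - j) (W.l i' - j') with hr | hr | hr
    · exact .inl (.inl hr)
    · by_cases hi : i = i'
      · subst hi
        exact absurd (congrArg (Turn.y i) (Fin.ext (by omega))) h
      · exact (yBefore_or_yBefore hi).imp (fun h => .inr ⟨hr, h⟩) fun h => .inr ⟨hr.symm, h⟩
    · exact .inr (.inl hr)

theorem Turn.next_x_of_lt {i : W.Base} {j : Fin (W.k i)} (h : 1 < W.k i - j) :
    (Turn.x i j).next = .x i ⟨j + 1, by omega⟩ :=
  dif_pos (by omega)

theorem Turn.next_x_of_eq {i : W.Base} {j : Fin (W.k i)} (h : W.k i - j = 1) :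
    (Turn.x i j).next = .y i ⟨0, W.yExp_pos i.1 i.2⟩ :=
  dif_neg (by omega)

theorem Turn.next_y_of_lt {i : W.Base} {j : Fin (W.l i)} (h : 1 < W.l i - j) :
    (Turn.y i j).next = .y i ⟨j + 1, by omega⟩ :=
  dif_pos (by omega)

theorem Turn.next_y_of_eq {i : W.Base} {j : Fin (W.l i)} (h : W.l i - j = 1) :
    (Turn.y i j).next = .x (W.succ i) ⟨0, W.xExp_pos (W.succ i).1 (W.succ i).2⟩ :=
  dif_neg (by omega)

/-- An ear does not change the order of the turns that run through it. -/
theorem Turn.Before.next {u v : W.Turn} (hl : u.letter = v.letter) (h : u.Before v) :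
    u.next.Before v.next := by
  rcases u with ⟨i, j⟩ | ⟨i, j⟩ <;> rcases v with ⟨i', j'⟩ | ⟨i', j'⟩
  · have h1 := j.2
    have h2 := j'.2
    rcases eq_or_lt_of_le (show 1 ≤ W.k i' - j' by omega) with hv | hv
    · rw [next_x_of_eq hv.symm]
      rcases h with h | ⟨h, hx⟩
      · rw [next_x_of_lt (by omega)]
        trivial
      · rw [next_x_of_eq (by omega)]
        simpa [Before] using hx.lt_or_yBefore
    · have hu : 1 < W.k i - j := by rcases h with h | h <;> omega
      rw [next_x_of_lt hv, next_x_of_lt hu]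
      rcases h with h | ⟨h, hx⟩
      · left; simp only; omega
      · right; exact ⟨by simp only; omega, hx⟩
  · cases hl
  · cases hl
  · have h1 := j.2
    have h2 := j'.2
    rcases eq_or_lt_of_le (show 1 ≤ W.l i - j by omega) with hv | hv
    · rw [next_y_of_eq hv.symm]
      rcases h with h | ⟨h, hx⟩
      · rw [next_y_of_lt (by omega)]
        trivial
      · rw [next_y_of_eq (by omega)]
        simpa [Before] using hx.lt_or_xBefore
    · have hu : 1 < W.l i' - j' := by rcases h with h | h <;> omega
      rw [next_y_of_lt hv, next_y_of_lt hu]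
      rcases h with h | ⟨h, hx⟩
      · left; simp only; omega
      · right; exact ⟨by simp only; omega, hx⟩

instance : Finite W.Turn := by
  let f : (Σ i : W.Base, Fin (W.k i)) ⊕ (Σ i : W.Base, Fin (W.l i)) → W.Turn :=
    Sum.elim (fun z => .x z.1 z.2) fun z => .y z.1 z.2
  refine Finite.of_surjective f ?_
  rintro (⟨i, j⟩ | ⟨i, j⟩)
  · exact ⟨.inl ⟨i, j⟩, rfl⟩
  · exact ⟨.inr ⟨i, j⟩, rfl⟩

theorem Turn.next_surjective : Function.Surjective (Turn.next : W.Turn → W.Turn) := by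
  rintro (⟨i, j⟩ | ⟨i, j⟩)
  · rcases Nat.eq_zero_or_pos j with h | h
    · obtain ⟨i', rfl⟩ : ∃ i', W.succ i' = i :=
        (Finite.injective_iff_surjective.1 succ_injective) i
      refine ⟨W.lastY i', ?_⟩
      have := W.yExp_pos i'.1 i'.2
      rw [lastY, next_y_of_eq (by simp only [l] at *; omega)]
      congr 1
      exact Fin.ext h.symm
    · refine ⟨.x i ⟨j - 1, by omega⟩, ?_⟩
      rw [next_x_of_lt (by simp only; omega)]
      congr 1
      exact Fin.ext (Nat.sub_add_cancel h)
  · rcases Nat.eq_zero_or_pos j with h | h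
    · refine ⟨W.lastX i, ?_⟩
      have := W.xExp_pos i.1 i.2
      rw [lastX, next_x_of_eq (by simp only [k] at *; omega)]
      congr 1
      exact Fin.ext h.symm
    · refine ⟨.y i ⟨j - 1, by omega⟩, ?_⟩
      rw [next_y_of_lt (by simp only; omega)]
      congr 1
      exact Fin.ext (Nat.sub_add_cancel h)

theorem Turn.next_injective : Function.Injective (Turn.next : W.Turn → W.Turn) :=
  Finite.injective_iff_surjective.2 next_surjective

theorem remaining_lastX (i : W.Base) : W.k i - (W.k i - 1) = 1 := by
  have := W.xExp_pos i.1 i.2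
  simp only [k] at *; omega

theorem remaining_lastY (i : W.Base) : W.l i - (W.l i - 1) = 1 := by
  have := W.yExp_pos i.1 i.2
  simp only [l] at *; omega

end CodeWords

open CodeWords

/-! ### The ears in the plane orthogonal to the branch line -/

/-- The closed curve that an ear follows in the plane orthogonal to the branch line. -/
noncomputable def earLoop (e : Letter) (t : ℝ) : ℝ × ℝ := (earPoint e 0 t).2

theorem earPoint_eq (e : Letter) (h t : ℝ) : earPoint e h t = (h, earLoop e t) := by
  cases e <;> rfl

/-- The distance of an ear at time `t` from the axis it winds around. -/
noncomputable def earRadius : Letter → ℝ → ℝ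
  | .x, t => 1 + t * (1 - t)
  | .y, t => 1 - t * (1 - t)

theorem earLoop_eq (e : Letter) (t : ℝ) : earLoop e t =
    (earRadius e t * Real.cos (2 * Real.pi * t), earRadius e t * Real.sin (2 * Real.pi * t)) := by
  cases e <;> rfl

theorem earRadius_pos (e : Letter) {t : ℝ} (ht : t ∈ Set.Icc (0 : ℝ) 1) : 0 < earRadius e t := by
  obtain ⟨h0, h1⟩ := ht
  cases e
  · simp only [earRadius]; nlinarith [mul_nonneg h0 (sub_nonneg.2 h1)]
  · simp only [earRadius]; nlinarith [sq_nonneg (t - 1 / 2)]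

theorem continuous_earLoop (e : Letter) : Continuous (earLoop e) := by
  cases e <;> (unfold earLoop earPoint; fun_prop)

theorem earLoop_zero (e : Letter) : earLoop e 0 = (1, 0) := by cases e <;> simp [earLoop, earPoint]

theorem earLoop_one (e : Letter) : earLoop e 1 = (1, 0) := by cases e <;> simp [earLoop, earPoint]

/-- The time in `(-1/2, 1/2]` at which an ear passes the ray from the axis through a point of the
plane. Time `0` is the branch line, and negative times belong to the end of an ear. -/
noncomputable def splitTime (w : ℝ × ℝ) : ℝ := Complex.arg ⟨w.1, w.2⟩ / (2 * Real.pi)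

/-- The time in `(0, 1]` at which an ear passes the ray from the axis through a point of the
plane. -/
noncomputable def earTime (w : ℝ × ℝ) : ℝ := Complex.arg ⟨-w.1, -w.2⟩ / (2 * Real.pi) + 1 / 2

theorem splitTime_polar {r t : ℝ} (hr : 0 < r) (ht : t ∈ Set.Ioc (-1 / 2 : ℝ) (1 / 2)) :
    splitTime (r * Real.cos (2 * Real.pi * t), r * Real.sin (2 * Real.pi * t)) = t := by
  have hpi := Real.pi_pos
  have h := Complex.arg_mul_cos_add_sin_mul_I hr (θ := 2 * Real.pi * t)
    ⟨by nlinarith [ht.1], by nlinarith [ht.2]⟩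
  have e : (⟨r * Real.cos (2 * Real.pi * t), r * Real.sin (2 * Real.pi * t)⟩ : ℂ) =
      r * (Complex.cos ((2 * Real.pi * t : ℝ)) +
        Complex.sin ((2 * Real.pi * t : ℝ)) * Complex.I) := by
    rw [← Complex.ofReal_cos, ← Complex.ofReal_sin]
    apply Complex.ext <;> simp [-Complex.ofReal_cos, -Complex.ofReal_sin]
  simp only [splitTime]
  rw [e, h]
  field_simp

theorem earTime_polar {r t : ℝ} (hr : 0 < r) (ht : t ∈ Set.Ioc (0 : ℝ) 1) :
    earTime (r * Real.cos (2 * Real.pi * t), r * Real.sin (2 * Real.pi * t)) = t := by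
  have h := splitTime_polar hr (t := t - 1 / 2) ⟨by linarith [ht.1], by linarith [ht.2]⟩
  have e : 2 * Real.pi * (t - 1 / 2) = 2 * Real.pi * t - Real.pi := by ring
  rw [e, Real.cos_sub_pi, Real.sin_sub_pi] at h
  simp only [splitTime, mul_neg] at h
  simp only [earTime]
  linarith

theorem splitTime_earLoop_of_lt (e : Letter) {t : ℝ} (ht : t ∈ Set.Ico (0 : ℝ) (1 / 2)) :
    splitTime (earLoop e t) = t := by
  rw [earLoop_eq]
  exact splitTime_polar (earRadius_pos e ⟨ht.1, by linarith [ht.2]⟩)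
    ⟨by linarith [ht.1], ht.2.le⟩

theorem splitTime_earLoop_of_gt (e : Letter) {t : ℝ} (ht : t ∈ Set.Ioc (1 / 2 : ℝ) 1) :
    splitTime (earLoop e t) = t - 1 := by
  have h := splitTime_polar (earRadius_pos e ⟨by linarith [ht.1], ht.2⟩) (t := t - 1)
    ⟨by linarith [ht.1], by linarith [ht.2]⟩
  have e' : 2 * Real.pi * (t - 1) = 2 * Real.pi * t - 2 * Real.pi := by ring
  rw [e', Real.cos_sub_two_pi, Real.sin_sub_two_pi] at h
  rw [earLoop_eq, h]

theorem earTime_earLoop (e : Letter) {t : ℝ} (ht : t ∈ Set.Ioc (0 : ℝ) 1) :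
    earTime (earLoop e t) = t := by
  rw [earLoop_eq]
  exact earTime_polar (earRadius_pos e ⟨ht.1.le, ht.2⟩) ht

theorem earLoop_eq_one_zero_iff (e : Letter) {t : ℝ} (ht : t ∈ Set.Icc (0 : ℝ) 1) :
    earLoop e t = (1, 0) ↔ t = 0 ∨ t = 1 := by
  refine ⟨fun h => ?_, ?_⟩
  · rcases eq_or_lt_of_le ht.1 with h0 | h0
    · exact .inl h0.symm
    · right
      have h1 := earTime_earLoop e ⟨h0, ht.2⟩
      rw [h, ← earLoop_one e, earTime_earLoop e ⟨one_pos, le_rfl⟩] at h1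
      exact h1.symm
  · rintro (rfl | rfl)
    · exact earLoop_zero e
    · exact earLoop_one e

/-- The ears meet at the branch line only. -/
theorem earLoop_inj {e e' : Letter} {t t' : ℝ} (ht : t ∈ Set.Ioo (0 : ℝ) 1)
    (ht' : t' ∈ Set.Icc (0 : ℝ) 1) (h : earLoop e t = earLoop e' t') : e = e' ∧ t = t' := by
  have h0 : 0 < t' := by
    refine lt_of_le_of_ne ht'.1 fun h0 => ?_
    rw [← h0, earLoop_zero, earLoop_eq_one_zero_iff e ⟨ht.1.le, ht.2.le⟩] at h
    rcases h with h | h <;> linarith [ht.1, ht.2]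
  have htt : t = t' := by
    rw [← earTime_earLoop e ⟨ht.1, ht.2.le⟩, h, earTime_earLoop e' ⟨h0, ht'.2⟩]
  subst htt
  refine ⟨?_, rfl⟩
  rw [earLoop_eq, earLoop_eq] at h
  have hr : earRadius e t = earRadius e' t := by
    have h1 := congrArg Prod.fst h
    have h2 := congrArg Prod.snd h
    simp only at h1 h2
    have h3 := Real.cos_sq_add_sin_sq (2 * Real.pi * t)
    have h4 : earRadius e t ^ 2 = earRadius e' t ^ 2 := by
      calc earRadius e t ^ 2 = (earRadius e t * Real.cos (2 * Real.pi * t)) ^ 2 +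
            (earRadius e t * Real.sin (2 * Real.pi * t)) ^ 2 := by
              rw [mul_pow, mul_pow, ← mul_add, h3, mul_one]
        _ = earRadius e' t ^ 2 := by
              rw [h1, h2, mul_pow, mul_pow, ← mul_add, h3, mul_one]
    exact (sq_eq_sq₀ (earRadius_pos e ht').le (earRadius_pos e' ht').le).1 h4
  have := mul_pos ht.1 (sub_pos.2 ht.2)
  cases e <;> cases e' <;> first | rfl | (simp only [earRadius] at hr; linarith)

theorem continuousAt_splitTime {w : ℝ × ℝ} (hw : 0 < w.1) : ContinuousAt splitTime w := by
  have h1 : ContinuousAt Complex.arg ⟨w.1, w.2⟩ :=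
    Complex.continuousAt_arg (by simp [Complex.mem_slitPlane_iff, hw])
  have h2 : Continuous fun w : ℝ × ℝ => (⟨w.1, w.2⟩ : ℂ) :=
    Complex.equivRealProdCLM.symm.continuous
  have h3 : ContinuousAt (fun w : ℝ × ℝ => Complex.arg ⟨w.1, w.2⟩) w :=
    ContinuousAt.comp (f := fun w : ℝ × ℝ => (⟨w.1, w.2⟩ : ℂ)) h1 h2.continuousAt
  exact h3.div_const _

theorem continuousAt_earTime {w : ℝ × ℝ} (hw : w.1 < 0 ∨ w.2 ≠ 0) : ContinuousAt earTime w := by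
  have h1 : ContinuousAt Complex.arg ⟨-w.1, -w.2⟩ :=
    Complex.continuousAt_arg (by simpa [Complex.mem_slitPlane_iff] using hw)
  have h2 : Continuous fun w : ℝ × ℝ => (⟨-w.1, -w.2⟩ : ℂ) :=
    Complex.equivRealProdCLM.symm.continuous.comp continuous_neg
  have h3 : ContinuousAt (fun w : ℝ × ℝ => Complex.arg ⟨-w.1, -w.2⟩) w :=
    ContinuousAt.comp (f := fun w : ℝ × ℝ => (⟨-w.1, -w.2⟩ : ℂ)) h1 h2.continuousAt
  exact (h3.div_const _).add_const _

theorem earLoop_mem_of_mem_Ioo (e : Letter) {t : ℝ} (ht : t ∈ Set.Ioo (0 : ℝ) 1) :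
    (earLoop e t).1 < 0 ∨ (earLoop e t).2 ≠ 0 := by
  by_contra! hc
  have hr := earRadius_pos e (Set.Ioo_subset_Icc_self ht)
  rw [earLoop_eq] at hc
  simp only [mul_eq_zero, hr.ne', false_or] at hc
  obtain ⟨h1, h2⟩ := hc
  have hcos : 0 ≤ Real.cos (2 * Real.pi * t) := nonneg_of_mul_nonneg_right h1 hr
  have hpi := Real.pi_pos
  -- The angle lies strictly between `0` and `2π`, and its sine vanishes at `π` only.
  have hs : Real.sin (2 * Real.pi * t - Real.pi) = 0 := by rw [Real.sin_sub_pi, h2, neg_zero]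
  have h0 := (Real.sin_eq_zero_iff_of_lt_of_lt (by nlinarith [ht.1]) (by nlinarith [ht.2])).1 hs
  have : 2 * Real.pi * t = Real.pi := by linarith
  rw [this, Real.cos_pi] at hcos
  linarith

namespace TemplateLink

/-! ### The order of the turns of a link -/

variable {c : ℕ} {W : CodeWords c} {p q : ℝ} (L : TemplateLink W p q)

theorem pos_zero_injective : Function.Injective fun u => L.pos u 0 := by
  intro u v h
  have := @L.injOn (u, 0) ⟨trivial, by simp⟩ (v, 0) ⟨trivial, by simp⟩ (by
    simp only [earPoint_eq, earLoop_zero] at h ⊢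
    rw [h])
  exact congrArg Prod.fst this

theorem pos_ne_pos {u v : W.Turn} (hl : u.letter = v.letter) (huv : u ≠ v) {t : ℝ}
    (ht : t ∈ Set.Icc (0 : ℝ) 1) : L.pos u t ≠ L.pos v t := by
  intro h
  rcases eq_or_lt_of_le ht.2 with h1 | h1
  · rw [h1, L.pos_one, L.pos_one] at h
    exact huv (Turn.next_injective (L.pos_zero_injective h))
  · have := @L.injOn (u, t) ⟨trivial, ht.1, h1⟩ (v, t) ⟨trivial, ht.1, h1⟩
      (by simp only [h, hl])
    exact huv (congrArg Prod.fst this)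

/-- Strands of one ear do not cross, by the intermediate value theorem. -/
theorem pos_lt_pos {u v : W.Turn} (hl : u.letter = v.letter) (h : L.pos u 0 < L.pos v 0) {t : ℝ}
    (ht : t ∈ Set.Icc (0 : ℝ) 1) : L.pos u t < L.pos v t := by
  by_contra! hc
  have hsub : Set.Icc 0 t ⊆ Set.Icc (0 : ℝ) 1 := Set.Icc_subset_Icc_right ht.2
  have hcont : ContinuousOn (fun s => L.pos v s - L.pos u s) (Set.Icc 0 t) :=
    ((L.continuousOn_pos v).mono hsub).sub ((L.continuousOn_pos u).mono hsub)
  obtain ⟨s, hs, hs0⟩ := intermediate_value_Icc' ht.1 hcont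
    (show (0 : ℝ) ∈ Set.Icc _ _ from ⟨by linarith, by linarith⟩)
  simp only at hs0
  exact L.pos_ne_pos hl (by rintro rfl; exact h.false) (hsub hs) (by linarith)

/-- The order of two turns of one ear can be read off from their end points. -/
theorem start_lt_of_next_lt {u v : W.Turn} (hl : u.letter = v.letter)
    (h : L.pos u.next 0 < L.pos v.next 0) : L.pos u 0 < L.pos v 0 := by
  by_contra! hc
  have hne : u ≠ v := by rintro rfl; exact h.false
  have h1 := L.pos_lt_pos hl.symm (lt_of_le_of_ne hc (L.pos_zero_injective.ne hne.symm))
    ⟨zero_le_one, le_rfl⟩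
  rw [L.pos_one, L.pos_one] at h1
  exact h1.asymm h

theorem x_lt_x_of_remaining_lt {i i' : W.Base} (j : Fin (W.k i)) (j' : Fin (W.k i'))
    (h : W.k i' - j' < W.k i - j) : L.pos (.x i j) 0 < L.pos (.x i' j') 0 := by
  obtain ⟨r, hr⟩ : ∃ r, W.k i' - j' = r + 1 := ⟨W.k i' - j' - 1, by omega⟩
  induction r generalizing j j' with
  | zero =>
    refine L.start_lt_of_next_lt rfl ?_
    rw [Turn.next_x_of_lt (by omega), Turn.next_x_of_eq hr]
    exact (L.neg_start _ _).trans (L.pos_start _ _)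
  | succ r ih =>
    refine L.start_lt_of_next_lt rfl ?_
    rw [Turn.next_x_of_lt (by omega), Turn.next_x_of_lt (by omega)]
    exact ih _ _ (by simp only; omega) (by simp only; omega)

theorem y_lt_y_of_remaining_lt {i i' : W.Base} (j : Fin (W.l i)) (j' : Fin (W.l i'))
    (h : W.l i - j < W.l i' - j') : L.pos (.y i j) 0 < L.pos (.y i' j') 0 := by
  obtain ⟨r, hr⟩ : ∃ r, W.l i - j = r + 1 := ⟨W.l i - j - 1, by omega⟩
  induction r generalizing j j' with
  | zero =>
    refine L.start_lt_of_next_lt rfl ?_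
    rw [Turn.next_y_of_eq hr, Turn.next_y_of_lt (by omega)]
    exact (L.neg_start _ _).trans (L.pos_start _ _)
  | succ r ih =>
    refine L.start_lt_of_next_lt rfl ?_
    rw [Turn.next_y_of_lt (by omega), Turn.next_y_of_lt (by omega)]
    exact ih _ _ (by simp only; omega) (by simp only; omega)

theorem x_lt_x_of_last_lt {i i' : W.Base} (j : Fin (W.k i)) (j' : Fin (W.k i'))
    (h : W.k i - j = W.k i' - j') (hlast : L.pos (W.lastX i) 0 < L.pos (W.lastX i') 0) :
    L.pos (.x i j) 0 < L.pos (.x i' j') 0 := by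
  obtain ⟨r, hr⟩ : ∃ r, W.k i - j = r + 1 := ⟨W.k i - j - 1, by omega⟩
  induction r generalizing j j' with
  | zero =>
    have e1 : Turn.x i j = W.lastX i := congrArg (Turn.x i) (Fin.ext (by simp only; omega))
    have e2 : Turn.x i' j' = W.lastX i' := congrArg (Turn.x i') (Fin.ext (by simp only; omega))
    rwa [e1, e2]
  | succ r ih =>
    refine L.start_lt_of_next_lt rfl ?_
    rw [Turn.next_x_of_lt (by omega), Turn.next_x_of_lt (by omega)]
    exact ih _ _ (by simp only; omega) (by simp only; omega)

theorem y_lt_y_of_last_lt {i i' : W.Base} (j : Fin (W.l i)) (j' : Fin (W.l i'))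
    (h : W.l i - j = W.l i' - j') (hlast : L.pos (W.lastY i) 0 < L.pos (W.lastY i') 0) :
    L.pos (.y i j) 0 < L.pos (.y i' j') 0 := by
  obtain ⟨r, hr⟩ : ∃ r, W.l i - j = r + 1 := ⟨W.l i - j - 1, by omega⟩
  induction r generalizing j j' with
  | zero =>
    have e1 : Turn.y i j = W.lastY i := congrArg (Turn.y i) (Fin.ext (by simp only; omega))
    have e2 : Turn.y i' j' = W.lastY i' := congrArg (Turn.y i') (Fin.ext (by simp only; omega))
    rwa [e1, e2]
  | succ r ih =>
    refine L.start_lt_of_next_lt rfl ?_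
    rw [Turn.next_y_of_lt (by omega), Turn.next_y_of_lt (by omega)]
    exact ih _ _ (by simp only; omega) (by simp only; omega)

/-- The last turns of two `x`-arcs lie in the order found by the procedure: each step of the
procedure follows the two strands through one more pair of arcs. -/
theorem lastX_lt_lastX {i j : W.Base} (h : W.XBefore i j) :
    L.pos (W.lastX i) 0 < L.pos (W.lastX j) 0 := by
  induction h with
  | ascending_l h =>
    refine L.start_lt_of_next_lt rfl ?_
    rw [lastX, lastX, Turn.next_x_of_eq (remaining_lastX _), Turn.next_x_of_eq (remaining_lastX _)]
    exact L.y_lt_y_of_remaining_lt _ _ h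
  | descending_k h1 h2 =>
    refine L.start_lt_of_next_lt rfl ?_
    rw [lastX, lastX, Turn.next_x_of_eq (remaining_lastX _), Turn.next_x_of_eq (remaining_lastX _)]
    refine L.y_lt_y_of_last_lt _ _ h1 (L.start_lt_of_next_lt rfl ?_)
    rw [lastY, lastY, Turn.next_y_of_eq (remaining_lastY _), Turn.next_y_of_eq (remaining_lastY _)]
    exact L.x_lt_x_of_remaining_lt _ _ h2
  | _ h1 h2 _ ih =>
    refine L.start_lt_of_next_lt rfl ?_
    rw [lastX, lastX, Turn.next_x_of_eq (remaining_lastX _), Turn.next_x_of_eq (remaining_lastX _)]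
    refine L.y_lt_y_of_last_lt _ _ h1 (L.start_lt_of_next_lt rfl ?_)
    rw [lastY, lastY, Turn.next_y_of_eq (remaining_lastY _), Turn.next_y_of_eq (remaining_lastY _)]
    exact L.x_lt_x_of_last_lt _ _ h2 ih

theorem lastY_lt_lastY {i j : W.Base} (h : W.YBefore i j) :
    L.pos (W.lastY i) 0 < L.pos (W.lastY j) 0 := by
  refine L.start_lt_of_next_lt rfl ?_
  rw [lastY, lastY, Turn.next_y_of_eq (remaining_lastY _), Turn.next_y_of_eq (remaining_lastY _)]
  rcases h.lt_or_xBefore with h | ⟨h, hx⟩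
  · exact L.x_lt_x_of_remaining_lt _ _ h
  · exact L.x_lt_x_of_last_lt _ _ h (L.lastX_lt_lastX hx)

/-- The order of the turns of a link on the branch line is determined by its words. -/
theorem pos_lt_pos_of_before {u v : W.Turn} (h : u.Before v) : L.pos u 0 < L.pos v 0 := by
  rcases u with ⟨i, j⟩ | ⟨i, j⟩ <;> rcases v with ⟨i', j'⟩ | ⟨i', j'⟩
  · rcases h with h | ⟨h, hx⟩
    · exact L.x_lt_x_of_remaining_lt _ _ h
    · exact L.x_lt_x_of_last_lt _ _ h (L.lastX_lt_lastX hx)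
  · exact (L.neg_start _ _).trans (L.pos_start _ _)
  · exact h.elim
  · rcases h with h | ⟨h, hx⟩
    · exact L.y_lt_y_of_remaining_lt _ _ h
    · exact L.y_lt_y_of_last_lt _ _ h (L.lastY_lt_lastY hx)

theorem isFullXBunchOrder {σ : Fin W.nbar ≃ W.Base} (hσ : W.IsXOrder σ) :
    L.IsFullXBunchOrder σ := by
  refine ⟨fun s t hst => L.lastX_lt_lastX (hσ s t hst), fun i j hj s => ?_⟩
  refine L.x_lt_x_of_remaining_lt _ _ ?_
  rw [remaining_lastX]
  have h1 := j.2
  refine lt_of_le_of_ne (by omega) fun h => hj (σ.symm i) ?_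
  rw [Equiv.apply_symm_apply]
  exact congrArg (Turn.x i) (Fin.ext (by simp only; omega))

theorem isFullYBunchOrder {τ : Fin W.nbar ≃ W.Base} (hτ : W.IsYOrder τ) :
    L.IsFullYBunchOrder τ := by
  refine ⟨fun s t hst => L.lastY_lt_lastY (hτ s t hst), fun i j hj s => ?_⟩
  refine L.y_lt_y_of_remaining_lt _ _ ?_
  rw [remaining_lastY]
  have h1 := j.2
  refine lt_of_le_of_ne (by omega) fun h => hj (τ.symm i) ?_
  rw [Equiv.apply_symm_apply]
  exact congrArg (Turn.y i) (Fin.ext (by simp only; omega))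

end TemplateLink

namespace CodeWords

/-! ### Drawing with straight strands -/

variable {c : ℕ} {W : CodeWords c} {p q : ℝ}

theorem k_le_kMax (i : W.Base) : W.k i ≤ W.kMax := Finset.le_sup (Finset.mem_univ i)

theorem l_le_lMax (i : W.Base) : W.l i ≤ W.lMax := Finset.le_sup (Finset.mem_univ i)

theorem IsXOrder.symm_lt_symm {σ : Fin W.nbar ≃ W.Base} (hσ : W.IsXOrder σ) {i j : W.Base}
    (h : W.XBefore i j) : σ.symm i < σ.symm j := by
  by_contra! hc
  rcases hc.eq_or_lt with hc | hc
  · rw [σ.symm.injective hc] at h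
    exact h.asymm h
  · have := hσ _ _ hc
    simp only [Equiv.apply_symm_apply] at this
    exact h.asymm this

theorem IsYOrder.symm_lt_symm {τ : Fin W.nbar ≃ W.Base} (hτ : W.IsYOrder τ) {i j : W.Base}
    (h : W.YBefore i j) : τ.symm i < τ.symm j := by
  by_contra! hc
  rcases hc.eq_or_lt with hc | hc
  · rw [τ.symm.injective hc] at h
    exact h.asymm h
  · have := hτ _ _ hc
    simp only [Equiv.apply_symm_apply] at this
    exact h.asymm this

namespace Marking

theorem nonempty : Nonempty W.Marking := by
  -- Subdivide each interval of length `4/5` evenly.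
  have key : ∀ (v : ℝ) (s : Fin W.nbar),
      v - 2 / 5 + ((s : ℝ) + 1) / (W.nbar + 1) * (4 / 5) ∈ Set.Ioo (v - 2 / 5) (v + 2 / 5) := by
    intro v s
    have hs : ((s : ℕ) : ℝ) + 1 ≤ W.nbar := by exact_mod_cast s.2
    have h0 : 0 < ((s : ℝ) + 1) / (W.nbar + 1) := by positivity
    have h1 : ((s : ℝ) + 1) / (W.nbar + 1) < 1 := by
      rw [div_lt_one (by positivity)]; linarith
    constructor <;> linarith
  have mono : ∀ v : ℝ,
      StrictMono fun s : Fin W.nbar => v - 2 / 5 + ((s : ℝ) + 1) / (W.nbar + 1) * (4 / 5) := by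
    intro v s t hst
    have hst' : ((s : ℕ) : ℝ) < (t : ℕ) := by exact_mod_cast hst
    simp only
    gcongr
  exact ⟨{ negPoint := fun v s => -(v : ℝ) - 2 / 5 + ((s : ℝ) + 1) / (W.nbar + 1) * (4 / 5)
           posPoint := fun v s => (v : ℝ) - 2 / 5 + ((s : ℝ) + 1) / (W.nbar + 1) * (4 / 5)
           negPoint_mem := fun v _ s => key _ s
           posPoint_mem := fun v _ s => key _ s
           negPoint_strictMono := fun v _ => mono _
           posPoint_strictMono := fun v _ => mono _ }⟩

variable (P : W.Marking) (σ τ : Fin W.nbar ≃ W.Base)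

/-- The marked point from which a turn is drawn: the index of the interval is the number of turns
left in the arc, this turn included. -/
def start : W.Turn → ℝ
  | .x i j => P.negPoint (W.k i - j) (σ.symm i)
  | .y i j => P.posPoint (W.l i - j) (τ.symm i)

theorem start_x_mem (i : W.Base) (j : Fin (W.k i)) : P.start σ τ (.x i j) ∈
    Set.Ioo (-((W.k i - j : ℕ) : ℝ) - 2 / 5) (-((W.k i - j : ℕ) : ℝ) + 2 / 5) :=
  P.negPoint_mem _ ⟨by omega, (Nat.sub_le _ _).trans (k_le_kMax i)⟩ _

theorem start_y_mem (i : W.Base) (j : Fin (W.l i)) : P.start σ τ (.y i j) ∈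
    Set.Ioo (((W.l i - j : ℕ) : ℝ) - 2 / 5) (((W.l i - j : ℕ) : ℝ) + 2 / 5) :=
  P.posPoint_mem _ ⟨by omega, (Nat.sub_le _ _).trans (l_le_lMax i)⟩ _

theorem start_x_neg (i : W.Base) (j : Fin (W.k i)) : P.start σ τ (.x i j) < 0 := by
  have h := (P.start_x_mem σ τ i j).2
  have h1 : (1 : ℝ) ≤ (W.k i - j : ℕ) := by exact_mod_cast (by omega : 1 ≤ W.k i - j)
  linarith

theorem start_y_pos (i : W.Base) (j : Fin (W.l i)) : 0 < P.start σ τ (.y i j) := by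
  have h := (P.start_y_mem σ τ i j).1
  have h1 : (1 : ℝ) ≤ (W.l i - j : ℕ) := by exact_mod_cast (by omega : 1 ≤ W.l i - j)
  linarith

theorem start_mem (hp : (W.kMax : ℝ) + 2 / 5 ≤ p) (hq : (W.lMax : ℝ) + 2 / 5 ≤ q) (u : W.Turn) :
    P.start σ τ u ∈ Set.Icc (-p) q := by
  have hk : (0 : ℝ) ≤ W.kMax := Nat.cast_nonneg _
  have hl : (0 : ℝ) ≤ W.lMax := Nat.cast_nonneg _
  rcases u with ⟨i, j⟩ | ⟨i, j⟩
  · have h := (P.start_x_mem σ τ i j).1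
    have h0 := P.start_x_neg σ τ i j
    have h1 : ((W.k i - j : ℕ) : ℝ) ≤ W.kMax := by
      exact_mod_cast (Nat.sub_le _ _).trans (k_le_kMax i)
    constructor <;> linarith
  · have h := (P.start_y_mem σ τ i j).2
    have h0 := P.start_y_pos σ τ i j
    have h1 : ((W.l i - j : ℕ) : ℝ) ≤ W.lMax := by
      exact_mod_cast (Nat.sub_le _ _).trans (l_le_lMax i)
    constructor <;> linarith

variable {σ τ}

/-- The marked points realise the order of the turns. -/
theorem start_lt_start (hσ : W.IsXOrder σ) (hτ : W.IsYOrder τ) {u v : W.Turn}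
    (h : u.Before v) : P.start σ τ u < P.start σ τ v := by
  rcases u with ⟨i, j⟩ | ⟨i, j⟩ <;> rcases v with ⟨i', j'⟩ | ⟨i', j'⟩
  · rcases h with h | ⟨h, hx⟩
    · have h1 := (P.start_x_mem σ τ i j).2
      have h2 := (P.start_x_mem σ τ i' j').1
      have h3 : ((W.k i' - j' : ℕ) : ℝ) + 1 ≤ (W.k i - j : ℕ) := by exact_mod_cast h
      linarith
    · simp only [start]
      rw [h]
      exact P.negPoint_strictMono _ ⟨by omega, (Nat.sub_le _ _).trans (k_le_kMax i')⟩
        (hσ.symm_lt_symm hx)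
  · exact (P.start_x_neg σ τ i j).trans (P.start_y_pos σ τ i' j')
  · exact h.elim
  · rcases h with h | ⟨h, hx⟩
    · have h1 := (P.start_y_mem σ τ i j).2
      have h2 := (P.start_y_mem σ τ i' j').1
      have h3 : ((W.l i - j : ℕ) : ℝ) + 1 ≤ (W.l i' - j' : ℕ) := by exact_mod_cast h
      linarith
    · simp only [start]
      rw [h]
      exact P.posPoint_strictMono _ ⟨by omega, (Nat.sub_le _ _).trans (l_le_lMax i')⟩
        (hτ.symm_lt_symm hx)

theorem start_injective (hσ : W.IsXOrder σ) (hτ : W.IsYOrder τ) :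
    Function.Injective (P.start σ τ) := by
  intro u v h
  by_contra hne
  rcases Turn.before_or_before hne with h' | h'
  · exact (P.start_lt_start hσ hτ h').ne h
  · exact (P.start_lt_start hσ hτ h').ne' h

/-- Straight strands of one ear do not cross, since their starting points and their end points lie
in the same order. -/
theorem straight_ne (hσ : W.IsXOrder σ) (hτ : W.IsYOrder τ) {u v : W.Turn}
    (hl : u.letter = v.letter) (huv : u ≠ v) {t : ℝ} (ht : t ∈ Set.Icc (0 : ℝ) 1) :
    (1 - t) * P.start σ τ u + t * P.start σ τ u.next ≠
      (1 - t) * P.start σ τ v + t * P.start σ τ v.next := by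
  have key : ∀ {u v : W.Turn}, u.letter = v.letter → u.Before v →
      (1 - t) * P.start σ τ u + t * P.start σ τ u.next <
        (1 - t) * P.start σ τ v + t * P.start σ τ v.next := by
    intro u v hl h
    have h1 := P.start_lt_start hσ hτ h
    have h2 := P.start_lt_start hσ hτ (h.next hl)
    rcases eq_or_lt_of_le ht.1 with h0 | h0
    · rw [← h0]; linarith
    · have h3 := mul_lt_mul_of_pos_left h2 h0
      have h4 := mul_le_mul_of_nonneg_left h1.le (sub_nonneg.2 ht.2)
      linarith
  rcases Turn.before_or_before huv with h | h
  · exact (key hl h).ne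
  · exact (key hl.symm h).ne'

theorem straight_mem (hp : (W.kMax : ℝ) + 2 / 5 ≤ p) (hq : (W.lMax : ℝ) + 2 / 5 ≤ q)
    (u : W.Turn) {t : ℝ} (ht : t ∈ Set.Icc (0 : ℝ) 1) :
    (1 - t) * P.start σ τ u + t * P.start σ τ u.next ∈ earSection p q u.letter t := by
  have h1 := P.start_mem σ τ hp hq u
  have h2 := P.start_mem σ τ hp hq u.next
  have ht' := sub_nonneg.2 ht.2
  have a1 := mul_le_mul_of_nonneg_left h1.1 ht'
  have a2 := mul_le_mul_of_nonneg_left h1.2 ht'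
  have a3 := mul_le_mul_of_nonneg_left h2.1 ht.1
  have a4 := mul_le_mul_of_nonneg_left h2.2 ht.1
  rcases u with ⟨i, j⟩ | ⟨i, j⟩
  · have a5 := mul_le_mul_of_nonneg_left (P.start_x_neg σ τ i j).le ht'
    constructor <;> linarith
  · have a5 := mul_le_mul_of_nonneg_left (P.start_y_pos σ τ i j).le ht'
    constructor <;> linarith

/-- The link drawn with straight strands from a marking. -/
noncomputable def straightLink (hσ : W.IsXOrder σ) (hτ : W.IsYOrder τ)
    (hp : (W.kMax : ℝ) + 2 / 5 ≤ p) (hq : (W.lMax : ℝ) + 2 / 5 ≤ q) : TemplateLink W p q where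
  pos u t := (1 - t) * P.start σ τ u + t * P.start σ τ u.next
  continuousOn_pos u := by fun_prop
  pos_mem u t ht := P.straight_mem hp hq u ht
  pos_one u := by ring
  neg_start i j := by simpa using P.start_x_neg σ τ i j
  pos_start i j := by simpa using P.start_y_pos σ τ i j
  injOn := by
    rintro ⟨u, t⟩ ⟨-, ht⟩ ⟨v, t'⟩ ⟨-, ht'⟩ h
    simp only [earPoint_eq, Prod.mk.injEq] at h
    obtain ⟨h1, h2⟩ := h
    simp only at ht ht'
    rcases eq_or_lt_of_le ht.1 with h0 | h0
    · subst h0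
      have h3 : t' = 0 := by
        rw [earLoop_zero] at h2
        exact ((earLoop_eq_one_zero_iff _ ⟨ht'.1, ht'.2.le⟩).1 h2.symm).resolve_right ht'.2.ne
      subst h3
      simp only [sub_zero, one_mul, zero_mul, add_zero] at h1
      rw [P.start_injective hσ hτ h1]
    · obtain ⟨h3, rfl⟩ := earLoop_inj ⟨h0, ht.2⟩ ⟨ht'.1, ht'.2.le⟩ h2
      by_contra hne
      exact P.straight_ne hσ hτ h3 (fun h => hne (by rw [h])) ⟨ht.1, ht.2.le⟩ h1

theorem straightLink_isDrawnFrom (hσ : W.IsXOrder σ) (hτ : W.IsYOrder τ)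
    (hp : (W.kMax : ℝ) + 2 / 5 ≤ p) (hq : (W.lMax : ℝ) + 2 / 5 ≤ q) :
    (P.straightLink hσ hτ hp hq).IsDrawnFrom P σ τ := by
  constructor <;> intro i j <;> simp [straightLink, start]

theorem straightLink_isStraight (hσ : W.IsXOrder σ) (hτ : W.IsYOrder τ)
    (hp : (W.kMax : ℝ) + 2 / 5 ≤ p) (hq : (W.lMax : ℝ) + 2 / 5 ≤ q) :
    (P.straightLink hσ hτ hp hq).IsStraight := by
  intro u t _
  simp [straightLink]

end Marking

end CodeWords

/-! ### Piecewise linear interpolation -/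

/-- The piecewise linear function that is the identity up to `α 0`, has the slope required by
`α i ↦ β i`, `α (i + 1) ↦ β (i + 1)` on each interval `[α i, α (i + 1)]` with `i + 1 < n`, and keeps
the last of these slopes from `α (n - 1)` on. -/
noncomputable def plInterp (α β : ℕ → ℝ) : ℕ → ℝ → ℝ
  | 0, h => h
  | n + 1, h => plInterp α β n (min h (α n)) +
      (β (n + 1) - β n) / (α (n + 1) - α n) * max (h - α n) 0

section plInterp

variable {α β : ℕ → ℝ}

theorem plInterp_of_le (hα : StrictMono α) (n : ℕ) {h : ℝ} (hh : h ≤ α 0) :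
    plInterp α β n h = h := by
  induction n with
  | zero => rfl
  | succ n ih =>
    have h1 : h ≤ α n := hh.trans (hα.monotone (Nat.zero_le n))
    rw [plInterp, min_eq_left h1, max_eq_right (by linarith), mul_zero, add_zero, ih]

theorem plInterp_apply (hα : StrictMono α) (h0 : α 0 = β 0) {n j : ℕ} (hj : j ≤ n) :
    plInterp α β n (α j) = β j := by
  induction n generalizing j with
  | zero => rw [Nat.le_zero.1 hj, plInterp, h0]
  | succ n ih =>
    rcases hj.eq_or_lt with rfl | hj
    · have h1 : α n < α (n + 1) := hα (Nat.lt_succ_self n)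
      have h2 : α (n + 1) - α n ≠ 0 := (sub_pos.2 h1).ne'
      rw [plInterp, min_eq_right h1.le, ih le_rfl, max_eq_left (sub_nonneg.2 h1.le),
        div_mul_cancel₀ _ h2]
      ring
    · have h1 : α j ≤ α n := hα.monotone (Nat.lt_succ_iff.1 hj)
      rw [plInterp, min_eq_left h1, max_eq_right (by linarith), mul_zero, add_zero,
        ih (Nat.lt_succ_iff.1 hj)]

theorem plInterp_of_ge (hα : StrictMono α) (h0 : α 0 = β 0) {n : ℕ} (h1 : α n = β n)
    (h2 : α (n + 1) = β (n + 1)) {h : ℝ} (hh : α n ≤ h) : plInterp α β (n + 1) h = h := by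
  have h3 : α (n + 1) - α n ≠ 0 := (sub_pos.2 (hα (Nat.lt_succ_self n))).ne'
  rw [plInterp, min_eq_right hh, max_eq_left (sub_nonneg.2 hh), ← h1, ← h2, div_self h3,
    plInterp_apply hα h0 le_rfl, ← h1]
  ring

theorem plInterp_strictMono (hα : StrictMono α) (hβ : StrictMono β) (n : ℕ) :
    StrictMono (plInterp α β n) := by
  induction n with
  | zero => exact strictMono_id
  | succ n ih =>
    intro h h' hh
    have hs : 0 < (β (n + 1) - β n) / (α (n + 1) - α n) :=
      div_pos (sub_pos.2 (hβ (Nat.lt_succ_self n))) (sub_pos.2 (hα (Nat.lt_succ_self n)))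
    simp only [plInterp]
    rcases lt_or_ge h (α n) with h1 | h1
    · refine add_lt_add_of_lt_of_le (ih ?_) ?_
      · rw [min_eq_left h1.le]
        exact lt_min hh h1
      · exact mul_le_mul_of_nonneg_left (max_le_max (by linarith) le_rfl) hs.le
    · refine add_lt_add_of_le_of_lt (ih.monotone (min_le_min hh.le le_rfl)) ?_
      refine mul_lt_mul_of_pos_left ?_ hs
      rw [max_eq_left (sub_nonneg.2 h1), max_eq_left (by linarith)]
      linarith

theorem continuous_plInterp {X : Type*} [TopologicalSpace X] {α β : X → ℕ → ℝ}
    (hα : ∀ i, Continuous fun x => α x i) (hβ : ∀ i, Continuous fun x => β x i)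
    (hα' : ∀ x, StrictMono (α x)) (n : ℕ) {f : X → ℝ} (hf : Continuous f) :
    Continuous fun x => plInterp (α x) (β x) n (f x) := by
  induction n generalizing f with
  | zero => exact hf
  | succ n ih =>
    simp only [plInterp]
    refine (ih (hf.min (hα n))).add (Continuous.mul ?_ ((hf.sub (hα n)).max continuous_const))
    exact ((hβ _).sub (hβ _)).div ((hα _).sub (hα _))
      fun x => (sub_pos.2 (hα' x (Nat.lt_succ_self n))).ne'

end plInterp

/-- The sequence `A, x₀, …, xₙ₋₁, B, B + 1, B + 2, …`. Interpolation between two such sequences has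
slope `1` beyond `B`, and so moves only points between `A` and `B`. -/
noncomputable def ladder (A B : ℝ) {n : ℕ} (x : Fin n → ℝ) : ℕ → ℝ
  | 0 => A
  | i + 1 => if h : i < n then x ⟨i, h⟩ else B + ((i : ℝ) - n)

theorem ladder_strictMono {A B : ℝ} {n : ℕ} {x : Fin n → ℝ} (hAB : A < B) (hx : StrictMono x)
    (hA : ∀ i, A < x i) (hB : ∀ i, x i < B) : StrictMono (ladder A B x) := by
  refine strictMono_nat_of_lt_succ fun i => ?_
  cases i with
  | zero =>
    simp only [ladder]
    split_ifs with h
    · exact hA _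
    · obtain rfl : n = 0 := by omega
      simpa using hAB
  | succ i =>
    simp only [ladder]
    split_ifs with h h' h'
    · exact hx (Nat.lt_succ_self i)
    · have : n = i + 1 := by omega
      subst this
      simpa using hB _
    · omega
    · push_cast; linarith

theorem ladder_top {A B : ℝ} {n : ℕ} (x : Fin n → ℝ) : ladder A B x (n + 1) = B := by
  simp [ladder]

theorem ladder_above_top {A B : ℝ} {n : ℕ} (x : Fin n → ℝ) : ladder A B x (n + 2) = B + 1 := by
  simp [ladder]

open Filter Topology

/-- Finitely many points `a i` of the line, moving with a parameter, can be carried to points `b i`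
in the same order by increasing functions depending continuously on the parameter near `w₀`. -/
theorem exists_local_interpolation {X : Type*} [TopologicalSpace X] {ι : Type*} [Finite ι]
    {w₀ : X} {a b : ι → X → ℝ} {A B : ℝ}
    (ha : ∀ i, ∀ᶠ w in 𝓝 w₀, ContinuousAt (a i) w) (hb : ∀ i, ∀ᶠ w in 𝓝 w₀, ContinuousAt (b i) w)
    (hab : ∀ i j, i ≠ j → (a i w₀ < a j w₀ ∧ b i w₀ < b j w₀) ∨ (a j w₀ < a i w₀ ∧ b j w₀ < b i w₀))
    (haAB : ∀ i, a i w₀ ∈ Set.Ioo A B) (hbAB : ∀ i, b i w₀ ∈ Set.Ioo A B) (hAB : A < B) :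
    ∃ g : X → C(ℝ, ℝ), ∃ N ∈ 𝓝 w₀, ContinuousOn g N ∧ ∀ w ∈ N, StrictMono (g w) ∧
      (∀ h, h ≤ A ∨ B ≤ h → g w h = h) ∧ ∀ i, g w (a i w) = b i w := by
  classical
  have := Fintype.ofFinite ι
  obtain ⟨n, hn⟩ : ∃ n, Fintype.card ι = n := ⟨_, rfl⟩
  obtain ⟨e, he⟩ := existsUnique_listing hn (fun i j => a i w₀ < a j w₀)
    (fun i j h h' => h.asymm h') (fun i j m h h' => h.trans h')
    fun i j hij => (hab i j hij).imp And.left And.left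
  have hea : ∀ s t, s < t → a (e s) w₀ < a (e t) w₀ := (he e).2 rfl
  have heb : ∀ s t, s < t → b (e s) w₀ < b (e t) w₀ := fun s t hst =>
    ((hab _ _ (e.injective.ne hst.ne)).resolve_right fun h => (hea s t hst).asymm h.1).2
  let N : Set X := {w | (∀ i, ContinuousAt (a i) w) ∧ (∀ i, ContinuousAt (b i) w) ∧
    StrictMono (fun s => a (e s) w) ∧ StrictMono (fun s => b (e s) w) ∧
    (∀ i, a i w ∈ Set.Ioo A B) ∧ ∀ i, b i w ∈ Set.Ioo A B}
  have ha0 : ∀ i, ContinuousAt (a i) w₀ := fun i => (ha i).self_of_nhds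
  have hb0 : ∀ i, ContinuousAt (b i) w₀ := fun i => (hb i).self_of_nhds
  have hN : N ∈ 𝓝 w₀ := by
    have h1 : ∀ᶠ w in 𝓝 w₀, ∀ s t, s < t → a (e s) w < a (e t) w :=
      eventually_all.2 fun s => eventually_all.2 fun t => eventually_all.2 fun hst =>
        (ha0 _).eventually_lt (ha0 _) (hea s t hst)
    have h2 : ∀ᶠ w in 𝓝 w₀, ∀ s t, s < t → b (e s) w < b (e t) w :=
      eventually_all.2 fun s => eventually_all.2 fun t => eventually_all.2 fun hst =>
        (hb0 _).eventually_lt (hb0 _) (heb s t hst)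
    have h3 : ∀ᶠ w in 𝓝 w₀, ∀ i, a i w ∈ Set.Ioo A B :=
      eventually_all.2 fun i => (ha0 i).eventually_mem (isOpen_Ioo.mem_nhds (haAB i))
    have h4 : ∀ᶠ w in 𝓝 w₀, ∀ i, b i w ∈ Set.Ioo A B :=
      eventually_all.2 fun i => (hb0 i).eventually_mem (isOpen_Ioo.mem_nhds (hbAB i))
    filter_upwards [eventually_all.2 ha, eventually_all.2 hb, h1, h2, h3, h4] with
      w k1 k2 k3 k4 k5 k6
    exact ⟨k1, k2, fun s t => k3 s t, fun s t => k4 s t, k5, k6⟩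
  let α : X → ℕ → ℝ := fun w => ladder A B fun s => a (e s) w
  let β : X → ℕ → ℝ := fun w => ladder A B fun s => b (e s) w
  have hα : ∀ w ∈ N, StrictMono (α w) := fun w hw =>
    ladder_strictMono hAB hw.2.2.1 (fun s => (hw.2.2.2.2.1 _).1) fun s => (hw.2.2.2.2.1 _).2
  have hβ : ∀ w ∈ N, StrictMono (β w) := fun w hw =>
    ladder_strictMono hAB hw.2.2.2.1 (fun s => (hw.2.2.2.2.2 _).1) fun s => (hw.2.2.2.2.2 _).2
  have hcont : Continuous fun z : N × ℝ => plInterp (α z.1) (β z.1) (n + 2) z.2 := by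
    have hl : ∀ f : ι → X → ℝ, (∀ w ∈ N, ∀ i, ContinuousAt (f i) w) → ∀ i,
        Continuous fun z : N × ℝ => ladder A B (fun s => f (e s) z.1) i := by
      intro f hf i
      cases i with
      | zero => exact continuous_const
      | succ i =>
        simp only [ladder]
        split_ifs with h
        · have h1 : Continuous fun w : N => f (e ⟨i, h⟩) w :=
            continuous_iff_continuousAt.2 fun w =>
              (hf w w.2 _).comp continuous_subtype_val.continuousAt
          exact h1.comp continuous_fst
        · exact continuous_const
    exact continuous_plInterp (hl a fun w hw => hw.1) (hl b fun w hw => hw.2.1)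
      (fun z => hα z.1 z.1.2) _ continuous_snd
  have hcont' : ∀ w ∈ N, Continuous (plInterp (α w) (β w) (n + 2)) := fun w hw =>
    hcont.comp (Continuous.prodMk_right (⟨w, hw⟩ : N))
  refine ⟨fun w => if hw : w ∈ N then ⟨plInterp (α w) (β w) (n + 2), hcont' w hw⟩ else .id ℝ, N, hN,
    ?_, fun w hw => ?_⟩
  · rw [continuousOn_iff_continuous_domRestrict]
    refine ContinuousMap.continuous_of_continuous_uncurry _ (hcont.congr fun z => ?_)
    simp [Function.uncurry, z.1.2]
  · simp only [hw, dif_pos, ContinuousMap.coe_mk]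
    refine ⟨plInterp_strictMono (hα w hw) (hβ w hw) _, fun h hh => ?_, fun i => ?_⟩
    · rcases hh with hh | hh
      · exact plInterp_of_le (hα w hw) _ hh
      · have hB : α w (n + 1) = B := ladder_top _
        exact plInterp_of_ge (β := β w) (hα w hw) rfl (hB.trans (ladder_top _).symm)
          ((ladder_above_top _).trans (ladder_above_top _).symm) (hB ▸ hh)
    · have h1 := plInterp_apply (hα w hw) (β := β w) rfl
        (show ((e.symm i : ℕ) + 1) ≤ n + 2 by omega)
      have h2 : α w ((e.symm i : ℕ) + 1) = a i w := by simp [α, ladder]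
      have h3 : β w ((e.symm i : ℕ) + 1) = b i w := by simp [β, ladder]
      rwa [h2, h3] at h1

/-! ### Maps that are increasing on fibres -/

/-- A continuous map of `ℝ × Y` over `Y` that is increasing and onto on each fibre is a
homeomorphism. -/
theorem exists_homeomorph_of_fiberwise {Y : Type*} [TopologicalSpace Y] {F : ℝ × Y → ℝ}
    (hF : Continuous F) (hmono : ∀ y, StrictMono fun h => F (h, y))
    (hsurj : ∀ y, Function.Surjective fun h => F (h, y)) :
    ∃ Φ : (ℝ × Y) ≃ₜ (ℝ × Y), ∀ z, Φ z = (F z, z.2) := by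
  choose g hg using hsurj
  simp only at hg
  have hg' : ∀ y h, g y (F (h, y)) = h := fun y h => (hmono y).injective (hg y _)
  refine ⟨{ toFun := fun z => (F z, z.2), invFun := fun z => (g z.2 z.1, z.2),
            left_inv := fun z => by simp [hg'], right_inv := fun z => by simp [hg],
            continuous_toFun := hF.prodMk continuous_snd, continuous_invFun := ?_ }, fun z => rfl⟩
  refine Continuous.prodMk (continuous_iff_continuousAt.2 fun z => ?_) continuous_snd
  refine tendsto_order.2 ⟨fun a ha => ?_, fun a ha => ?_⟩
  · have h1 : F (a, z.2) < z.1 := by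
      have := hmono z.2 ha
      simpa only [hg] using this
    have h2 : ContinuousAt (fun z : ℝ × Y => F (a, z.2)) z := by fun_prop
    filter_upwards [h2.eventually_lt continuousAt_fst h1] with x hx
    refine (hmono x.2).lt_iff_lt.1 ?_
    simpa only [hg] using hx
  · have h1 : z.1 < F (a, z.2) := by
      have := hmono z.2 ha
      simpa only [hg] using this
    have h2 : ContinuousAt (fun z : ℝ × Y => F (a, z.2)) z := by fun_prop
    filter_upwards [continuousAt_fst.eventually_lt h2 h1] with x hx
    refine (hmono x.2).lt_iff_lt.1 ?_
    simpa only [hg] using hx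

namespace TemplateLink

/-! ### The ambient isotopy between links with the same words -/

variable {c : ℕ} {W : CodeWords c} {p q : ℝ}

/-- The functions on the horizontal line over the point `w` of the plane orthogonal to the branch
line that are increasing, move no point outside `U`, and carry `L` to `D`. -/
def fiberMaps (L D : TemplateLink W p q) (U : Set Space) (w : ℝ × ℝ) : Set C(ℝ, ℝ) :=
  {f | StrictMono f ∧ (∀ h, ((h, w) : Space) ∉ U → f h = h) ∧
    ∀ u, ∀ t ∈ Set.Icc (0 : ℝ) 1, earLoop u.letter t = w → f (L.pos u t) = D.pos u t}

theorem convex_fiberMaps (L D : TemplateLink W p q) (U : Set Space) (w : ℝ × ℝ) :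
    Convex ℝ (fiberMaps L D U w) := by
  rintro f ⟨hf1, hf2, hf3⟩ g ⟨hg1, hg2, hg3⟩ a b ha hb hab
  refine ⟨fun h h' hh => ?_, fun h hh => ?_, fun u t ht hw => ?_⟩
  · simp only [ContinuousMap.add_apply, ContinuousMap.smul_apply, smul_eq_mul]
    have h1 := mul_le_mul_of_nonneg_left (hf1 hh).le ha
    have h2 := mul_le_mul_of_nonneg_left (hg1 hh).le hb
    rcases ha.eq_or_lt with rfl | ha
    · have : b = 1 := by linarith
      subst this
      have := hg1 hh
      linarith
    · have := mul_lt_mul_of_pos_left (hf1 hh) ha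
      linarith
  · simp only [ContinuousMap.add_apply, ContinuousMap.smul_apply, smul_eq_mul, hf2 h hh, hg2 h hh]
    rw [← add_mul, hab, one_mul]
  · simp only [ContinuousMap.add_apply, ContinuousMap.smul_apply, smul_eq_mul, hf3 u t ht hw,
      hg3 u t ht hw]
    rw [← add_mul, hab, one_mul]

/-- The words alone determine the order of the turns on the branch line. -/
theorem same_order (L D : TemplateLink W p q) {u v : W.Turn} (h : u ≠ v) :
    (L.pos u 0 < L.pos v 0 ∧ D.pos u 0 < D.pos v 0) ∨
      (L.pos v 0 < L.pos u 0 ∧ D.pos v 0 < D.pos u 0) :=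
  (Turn.before_or_before h).imp
    (fun h => ⟨L.pos_lt_pos_of_before h, D.pos_lt_pos_of_before h⟩)
    fun h => ⟨L.pos_lt_pos_of_before h, D.pos_lt_pos_of_before h⟩

/-- Fibre maps exist near `w₀` as soon as the points of `L` and `D` over all `w` near `w₀` occur
among the values of finitely many continuous functions `a i`, `b i`, which over `w₀` are distinct,
lie in the same order and lie in a segment inside `U`. The functions may have further values: it
does no harm to move additional points. -/
theorem exists_local_fiberMaps (L D : TemplateLink W p q) {U : Set Space} (hU : IsOpen U)
    {ι : Type*} [Finite ι] {w₀ : ℝ × ℝ} {a b : ι → ℝ × ℝ → ℝ} {lo hi : ℝ} (hle : lo ≤ hi)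
    (hsub : ∀ h ∈ Set.Icc lo hi, ((h, w₀) : Space) ∈ U)
    (ha : ∀ i, ∀ᶠ w in 𝓝 w₀, ContinuousAt (a i) w) (hb : ∀ i, ∀ᶠ w in 𝓝 w₀, ContinuousAt (b i) w)
    (hab : ∀ i j, i ≠ j → (a i w₀ < a j w₀ ∧ b i w₀ < b j w₀) ∨ (a j w₀ < a i w₀ ∧ b j w₀ < b i w₀))
    (ha' : ∀ i, a i w₀ ∈ Set.Icc lo hi) (hb' : ∀ i, b i w₀ ∈ Set.Icc lo hi)
    (hcov : ∀ᶠ w in 𝓝 w₀, ∀ u, ∀ t ∈ Set.Icc (0 : ℝ) 1, earLoop u.letter t = w →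
      ∃ i, a i w = L.pos u t ∧ b i w = D.pos u t) :
    ∃ N ∈ 𝓝 w₀, ∃ g : ℝ × ℝ → C(ℝ, ℝ), ContinuousOn g N ∧ ∀ w ∈ N, g w ∈ fiberMaps L D U w := by
  obtain ⟨V, V', hV, hV', hlV, hwV, hVU⟩ := generalized_tube_lemma (s := Set.Icc lo hi)
    isCompact_Icc (t := {w₀}) isCompact_singleton hU (by
      rintro ⟨h, w⟩ ⟨hh, hw⟩
      obtain rfl : w = w₀ := hw
      exact hsub h hh)
  obtain ⟨ε, hε, hεV⟩ := Metric.isOpen_iff.1 hV lo (hlV ⟨le_rfl, hle⟩)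
  obtain ⟨δ, hδ, hδV⟩ := Metric.isOpen_iff.1 hV hi (hlV ⟨hle, le_rfl⟩)
  have hin : Set.Ioo (lo - ε) (hi + δ) ⊆ V := by
    intro h hh
    rcases lt_or_ge h lo with h1 | h1
    · refine hεV ?_
      rw [Metric.mem_ball, Real.dist_eq, abs_lt]
      constructor <;> linarith [hh.1]
    · rcases lt_or_ge hi h with h2 | h2
      · refine hδV ?_
        rw [Metric.mem_ball, Real.dist_eq, abs_lt]
        constructor <;> linarith [hh.2]
      · exact hlV ⟨h1, h2⟩
  have hIoo : Set.Icc lo hi ⊆ Set.Ioo (lo - ε) (hi + δ) := fun h hh =>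
    ⟨by linarith [hh.1], by linarith [hh.2]⟩
  obtain ⟨g, N, hN, hg, hgN⟩ := exists_local_interpolation ha hb hab (fun i => hIoo (ha' i))
    (fun i => hIoo (hb' i)) (by linarith)
  refine ⟨N ∩ (V' ∩ {w | ∀ u : W.Turn, ∀ t ∈ Set.Icc (0 : ℝ) 1, earLoop u.letter t = w →
      ∃ i, a i w = L.pos u t ∧ b i w = D.pos u t}),
    inter_mem hN (inter_mem (hV'.mem_nhds (hwV rfl)) hcov), g, hg.mono Set.inter_subset_left, ?_⟩
  rintro w ⟨hw, hw', hw''⟩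
  obtain ⟨h1, h2, h3⟩ := hgN w hw
  refine ⟨h1, fun h hh => h2 h ?_, fun u t ht htw => ?_⟩
  · by_contra! hc
    exact hh (hVU ⟨hin hc, hw'⟩)
  · obtain ⟨i, hi1, hi2⟩ := hw'' u t ht htw
    rw [← hi1, ← hi2, h3]

theorem isClosed_earLoop_image (e : Letter) : IsClosed (earLoop e '' Set.Icc 0 1) :=
  (isCompact_Icc.image (continuous_earLoop e)).isClosed

theorem exists_earSection_eq_Icc (hp : 0 < p) (hq : 0 < q) (e : Letter) {t : ℝ}
    (ht : t ∈ Set.Icc (0 : ℝ) 1) : ∃ lo hi, lo ≤ hi ∧ earSection p q e t = Set.Icc lo hi := by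
  cases e
  · exact ⟨-p, t * q, by nlinarith [ht.1], rfl⟩
  · exact ⟨-(t * p), q, by nlinarith [ht.1], rfl⟩

theorem mem_template {e : Letter} {h t : ℝ} (ht : t ∈ Set.Icc (0 : ℝ) 1)
    (hh : h ∈ earSection p q e t) : ((h, earLoop e t) : Space) ∈ LorenzTemplate p q :=
  ⟨e, h, t, ht, hh, (earPoint_eq e h t).symm⟩

/-- Away from the branch line the points over `w` near an ear are those of the turns in this ear, at
the time given by the angle. -/
theorem exists_local_fiberMaps_interior (L D : TemplateLink W p q) (hp : 0 < p) (hq : 0 < q)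
    {U : Set Space} (hU : IsOpen U) (hTU : LorenzTemplate p q ⊆ U) (e : Letter) {t₀ : ℝ}
    (ht₀ : t₀ ∈ Set.Ioo (0 : ℝ) 1) :
    ∃ N ∈ 𝓝 (earLoop e t₀), ∃ g : ℝ × ℝ → C(ℝ, ℝ), ContinuousOn g N ∧
      ∀ w ∈ N, g w ∈ fiberMaps L D U w := by
  have ht₀' := Set.Ioo_subset_Icc_self ht₀
  obtain ⟨lo, hi, hle, hsec⟩ := exists_earSection_eq_Icc hp hq e ht₀'
  have htime : earTime (earLoop e t₀) = t₀ := earTime_earLoop e ⟨ht₀.1, ht₀.2.le⟩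
  have hcut : ∀ᶠ w in 𝓝 (earLoop e t₀), ContinuousAt earTime w := by
    have : IsOpen {w : ℝ × ℝ | w.1 < 0 ∨ w.2 ≠ 0} :=
      (isOpen_lt continuous_fst continuous_const).union
        (isOpen_ne_fun continuous_snd continuous_const)
    filter_upwards [this.mem_nhds (earLoop_mem_of_mem_Ioo e ht₀)] with w hw
    exact continuousAt_earTime hw
  have hIoo : ∀ᶠ w in 𝓝 (earLoop e t₀), earTime w ∈ Set.Ioo (0 : ℝ) 1 :=
    hcut.self_of_nhds.eventually_mem (isOpen_Ioo.mem_nhds (by rwa [htime]))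
  have hcont : ∀ (M : TemplateLink W p q) (u : W.Turn), ∀ᶠ w in 𝓝 (earLoop e t₀),
      ContinuousAt (fun w => M.pos u (earTime w)) w := by
    intro M u
    filter_upwards [hcut, hIoo] with w h1 h2
    exact ContinuousAt.comp (f := earTime)
      ((M.continuousOn_pos u).continuousAt (Icc_mem_nhds h2.1 h2.2)) h1
  refine exists_local_fiberMaps L D hU (ι := {u : W.Turn // u.letter = e}) hle
    (a := fun u w => L.pos u.1 (earTime w)) (b := fun u w => D.pos u.1 (earTime w))
    (fun h hh => hTU (mem_template ht₀' (hsec ▸ hh))) (fun u => hcont L u) (fun u => hcont D u)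
    ?_ ?_ ?_ ?_
  · rintro ⟨u, hu⟩ ⟨v, hv⟩ huv
    simp only [htime]
    exact (same_order L D (u := u) (v := v) fun h => huv (Subtype.ext h)).imp
      (fun h => ⟨L.pos_lt_pos (hu.trans hv.symm) h.1 ht₀',
        D.pos_lt_pos (hu.trans hv.symm) h.2 ht₀'⟩)
      fun h => ⟨L.pos_lt_pos (hv.trans hu.symm) h.1 ht₀',
        D.pos_lt_pos (hv.trans hu.symm) h.2 ht₀'⟩
  · rintro ⟨u, rfl⟩
    simp only [htime]
    exact hsec ▸ L.pos_mem u t₀ ht₀'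
  · rintro ⟨u, rfl⟩
    simp only [htime]
    exact hsec ▸ D.pos_mem u t₀ ht₀'
  · have hother : ∀ e', ∀ᶠ w in 𝓝 (earLoop e t₀), e' ≠ e → w ∉ earLoop e' '' Set.Icc 0 1 := by
      intro e'
      by_cases he : e' = e
      · simp [he]
      · refine Eventually.mono ((isClosed_earLoop_image e').isOpen_compl.mem_nhds ?_)
          fun w hw _ => hw
        rintro ⟨t, ht, h⟩
        exact he (earLoop_inj ht₀ ht h.symm).1.symm
    have hne : ∀ᶠ w in 𝓝 (earLoop e t₀), w ≠ (1, 0) := by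
      refine isOpen_ne.mem_nhds fun h => ?_
      rcases (earLoop_eq_one_zero_iff e ht₀').1 h with h | h <;> linarith [ht₀.1, ht₀.2]
    filter_upwards [hother .x, hother .y, hne] with w hx hy hw u t ht htw
    have hu : u.letter = e := by
      by_contra hu
      have : w ∈ earLoop u.letter '' Set.Icc 0 1 := ⟨t, ht, htw⟩
      cases h : u.letter <;> rw [h] at hu this
      · exact hx hu this
      · exact hy hu this
    have ht' : t ≠ 0 := fun h => hw (by rw [← htw, h, earLoop_zero])
    refine ⟨⟨u, hu⟩, ?_⟩
    rw [← htw, earTime_earLoop _ ⟨lt_of_le_of_ne ht.1 ht'.symm, ht.2⟩]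
    exact ⟨rfl, rfl⟩

/-- A strand that passes the branch line at time `0`: the end of the turn `u` at times `s ≤ 0`,
the beginning of the turn after `u` at times `s ≥ 0`. -/
noncomputable def crossing (L : TemplateLink W p q) (u : W.Turn) (s : ℝ) : ℝ :=
  L.pos u (min 1 (1 + s)) + L.pos u.next (max 0 s) - L.pos u 1

theorem crossing_of_nonpos (L : TemplateLink W p q) (u : W.Turn) {s : ℝ} (hs : s ≤ 0) :
    L.crossing u s = L.pos u (1 + s) := by
  rw [crossing, min_eq_right (by linarith), max_eq_left hs, L.pos_one]
  ring

theorem crossing_of_nonneg (L : TemplateLink W p q) (u : W.Turn) {s : ℝ} (hs : 0 ≤ s) :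
    L.crossing u s = L.pos u.next s := by
  rw [crossing, min_eq_left (by linarith), max_eq_right hs]
  ring

theorem continuousAt_crossing (L : TemplateLink W p q) (u : W.Turn) {s : ℝ}
    (hs : s ∈ Set.Ioo (-1 : ℝ) 1) : ContinuousAt (L.crossing u) s := by
  have h1 : ContinuousOn (fun s : ℝ => L.pos u (min 1 (1 + s))) (Set.Icc (-1) 1) :=
    (L.continuousOn_pos u).comp (by fun_prop) fun s hs =>
      ⟨le_min zero_le_one (by linarith [hs.1]), min_le_left _ _⟩
  have h2 : ContinuousOn (fun s : ℝ => L.pos u.next (max 0 s)) (Set.Icc (-1) 1) :=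
    (L.continuousOn_pos u.next).comp (by fun_prop) fun s hs =>
      ⟨le_max_left _ _, max_le zero_le_one hs.2⟩
  exact ((h1.add h2).sub continuousOn_const).continuousAt (Icc_mem_nhds hs.1 hs.2)

/-- Near the branch line, where four strips meet, the points over `w` occur among the crossings of
all turns, at the time given by the angle. -/
theorem exists_local_fiberMaps_branch (L D : TemplateLink W p q) (hp : 0 < p) (hq : 0 < q)
    {U : Set Space} (hU : IsOpen U) (hTU : LorenzTemplate p q ⊆ U) :
    ∃ N ∈ 𝓝 ((1, 0) : ℝ × ℝ), ∃ g : ℝ × ℝ → C(ℝ, ℝ), ContinuousOn g N ∧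
      ∀ w ∈ N, g w ∈ fiberMaps L D U w := by
  have h01 : (1 : ℝ) ∈ Set.Icc (0 : ℝ) 1 := ⟨zero_le_one, le_rfl⟩
  have htime : splitTime (1, 0) = 0 := by
    rw [← earLoop_zero .x, splitTime_earLoop_of_lt .x ⟨le_rfl, by norm_num⟩]
  have hright : ∀ᶠ w in 𝓝 ((1, 0) : ℝ × ℝ), 0 < w.1 :=
    (isOpen_lt continuous_const continuous_fst).mem_nhds (by simp)
  have hIoo : ∀ᶠ w in 𝓝 ((1, 0) : ℝ × ℝ), splitTime w ∈ Set.Ioo (-1 : ℝ) 1 :=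
    (continuousAt_splitTime (by simp)).eventually_mem
      (isOpen_Ioo.mem_nhds (by rw [htime]; constructor <;> norm_num))
  have hcont : ∀ (M : TemplateLink W p q) (u : W.Turn), ∀ᶠ w in 𝓝 ((1, 0) : ℝ × ℝ),
      ContinuousAt (fun w => M.crossing u (splitTime w)) w := by
    intro M u
    filter_upwards [hright, hIoo] with w h1 h2
    exact ContinuousAt.comp (f := splitTime) (M.continuousAt_crossing u h2)
      (continuousAt_splitTime h1)
  have hmem : ∀ (M : TemplateLink W p q) (u : W.Turn), M.pos u 0 ∈ Set.Icc (-p) q := by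
    intro M u
    have h := M.pos_mem u 0 ⟨le_rfl, zero_le_one⟩
    cases hu : u.letter <;> rw [hu] at h
    · exact ⟨h.1, h.2.trans (by linarith)⟩
    · exact ⟨le_trans (by linarith) h.1, h.2⟩
  refine exists_local_fiberMaps L D hU (ι := W.Turn) (lo := -p) (hi := q) (by linarith)
    (a := fun u w => L.crossing u (splitTime w)) (b := fun u w => D.crossing u (splitTime w))
    (fun h hh => hTU ?_) (hcont L) (hcont D) ?_ ?_ ?_ ?_
  · rw [← earLoop_one .x]
    exact mem_template h01 (by simpa [earSection] using hh)
  · intro u v huv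
    simp only [htime, crossing_of_nonneg _ _ le_rfl]
    exact same_order L D (Turn.next_injective.ne huv)
  · intro u
    simp only [htime, crossing_of_nonneg _ _ le_rfl]
    exact hmem L _
  · intro u
    simp only [htime, crossing_of_nonneg _ _ le_rfl]
    exact hmem D _
  · filter_upwards [hright] with w hw u t ht htw
    rcases lt_trichotomy t (1 / 2) with h | h | h
    · obtain ⟨u', rfl⟩ := Turn.next_surjective u
      refine ⟨u', ?_⟩
      rw [← htw, splitTime_earLoop_of_lt _ ⟨ht.1, h⟩, crossing_of_nonneg _ _ ht.1,
        crossing_of_nonneg _ _ ht.1]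
      exact ⟨rfl, rfl⟩
    · -- Halfway through an ear a strand is on the far side of the axis.
      exfalso
      rw [← htw, earLoop_eq, h] at hw
      have hr := earRadius_pos u.letter ht
      rw [h] at hr
      have e : 2 * Real.pi * (1 / 2) = Real.pi := by ring
      simp only [e, Real.cos_pi] at hw
      linarith
    · refine ⟨u, ?_⟩
      rw [← htw, splitTime_earLoop_of_gt _ ⟨h, ht.2⟩, crossing_of_nonpos _ _ (by linarith [ht.2]),
        crossing_of_nonpos _ _ (by linarith [ht.2]), add_sub_cancel]
      exact ⟨rfl, rfl⟩

/-- Fibre maps can be chosen continuously, by a partition of unity. -/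
theorem exists_continuous_fiberMaps (L D : TemplateLink W p q) (hp : 0 < p) (hq : 0 < q)
    {U : Set Space} (hU : IsOpen U) (hTU : LorenzTemplate p q ⊆ U) :
    ∃ f : C(ℝ × ℝ, C(ℝ, ℝ)), ∀ w, f w ∈ fiberMaps L D U w := by
  refine exists_continuous_forall_mem_convex_of_local (convex_fiberMaps L D U) fun w₀ => ?_
  by_cases hw : ∃ e, ∃ t ∈ Set.Icc (0 : ℝ) 1, earLoop e t = w₀
  · obtain ⟨e, t, ht, rfl⟩ := hw
    by_cases h1 : earLoop e t = (1, 0)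
    · rw [h1]
      exact exists_local_fiberMaps_branch L D hp hq hU hTU
    · rw [earLoop_eq_one_zero_iff e ht, not_or] at h1
      exact exists_local_fiberMaps_interior L D hp hq hU hTU e
        ⟨lt_of_le_of_ne ht.1 (Ne.symm h1.1), lt_of_le_of_ne ht.2 h1.2⟩
  · -- Off the ears there is nothing to move.
    push Not at hw
    have hopen : ∀ e, ∀ᶠ w in 𝓝 w₀, w ∉ earLoop e '' Set.Icc 0 1 := fun e =>
      (isClosed_earLoop_image e).isOpen_compl.mem_nhds fun ⟨t, ht, h⟩ => hw e t ht h
    refine ⟨_, (hopen .x).and (hopen .y), fun _ => .id ℝ, continuousOn_const, ?_⟩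
    rintro w ⟨hx, hy⟩
    refine ⟨strictMono_id, fun _ _ => rfl, fun u t ht h => ?_⟩
    cases hu : u.letter <;> rw [hu] at h
    · exact absurd ⟨t, ht, h⟩ hx
    · exact absurd ⟨t, ht, h⟩ hy

/-- Links with the same labelled words are ambient isotopic: the isotopy moves points horizontally,
interpolating linearly between the identity and the fibre maps. -/
theorem ambientIsotopic (L D : TemplateLink W p q) (hp : 0 < p) (hq : 0 < q) :
    L.AmbientIsotopic D := by
  intro U hU hTU
  -- Bounding `U` in the horizontal direction makes the fibre maps surjective.
  set R : ℝ := p + q + 1 with hR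
  obtain ⟨f, hf⟩ := exists_continuous_fiberMaps L D hp hq (U := U ∩ {z | |z.1| < R})
    (hU.inter (isOpen_lt (by fun_prop) continuous_const)) (by
      rintro z hz
      refine ⟨hTU hz, ?_⟩
      obtain ⟨e, h, t, ht, hh, rfl⟩ := hz
      rw [earPoint_eq]
      change |h| < R
      have h1 := mul_le_mul_of_nonneg_right ht.2 hp.le
      have h2 := mul_le_mul_of_nonneg_right ht.2 hq.le
      rw [abs_lt]
      cases e <;> constructor <;> linarith [hh.1, hh.2])
  let F : unitInterval → Space → ℝ := fun s z => (1 - (s : ℝ)) * z.1 + s * f z.2 z.1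
  have heval : Continuous fun z : Space => f z.2 z.1 :=
    (f.continuous.comp continuous_snd).eval continuous_fst
  have hFc : Continuous fun z : unitInterval × Space => F z.1 z.2 := by
    have := heval.comp (continuous_snd (X := unitInterval) (Y := Space))
    simp only [Function.comp_def] at this
    simp only [F]
    fun_prop
  have hF1 : ∀ s, Continuous (F s) := fun s => hFc.comp (Continuous.prodMk_right s)
  have hid : ∀ s (h : ℝ) (w : ℝ × ℝ), f w h = h → F s (h, w) = h := by
    intro s h w hh
    simp only [F, hh]
    ring
  have hmono : ∀ s w, StrictMono fun h => F s (h, w) := by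
    intro s w h h' hh
    simp only [F]
    have h1 := (hf w).1 hh
    have hs := s.2
    rcases hs.1.eq_or_lt with h0 | h0
    · rw [← h0]; linarith
    · have h2 := mul_lt_mul_of_pos_left h1 h0
      have h3 := mul_le_mul_of_nonneg_left hh.le (sub_nonneg.2 hs.2)
      linarith
  have hfar : ∀ s w (h : ℝ), R ≤ |h| → F s (h, w) = h := fun s w h hh =>
    hid s h w ((hf w).2.1 h fun hU => (not_lt.2 hh) hU.2)
  have hsurj : ∀ s w, Function.Surjective fun h => F s (h, w) := by
    intro s w
    refine Continuous.surjective ((hF1 s).comp (Continuous.prodMk_left w)) ?_ ?_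
    · refine tendsto_id.congr' ?_
      filter_upwards [eventually_ge_atTop R] with h hh
      exact (hfar s w h (hh.trans (le_abs_self h))).symm
    · refine tendsto_id.congr' ?_
      filter_upwards [eventually_le_atBot (-R)] with h hh
      exact (hfar s w h ((le_neg.1 hh).trans (neg_le_abs h))).symm
  choose H hH using fun s => exists_homeomorph_of_fiberwise (hF1 s) (hmono s) (hsurj s)
  have hcurve : ∀ s u, ∀ t ∈ Set.Icc (0 : ℝ) 1, H s (L.curve u t) =
      ((1 - (s : ℝ)) * L.pos u t + s * D.pos u t, earLoop u.letter t) := by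
    intro s u t ht
    rw [hH, curve, earPoint_eq]
    simp only [F, (hf _).2.2 u t ht rfl]
  refine ⟨H, ?_, fun z => ?_, fun s z hz => ?_, fun s u t ht => ?_, fun u t ht => ?_⟩
  · simp only [hH]
    exact hFc.prodMk (continuous_snd.comp continuous_snd)
  · rw [hH]
    simp [F]
  · rw [hH]
    exact Prod.ext (hid s z.1 z.2 ((hf z.2).2.1 z.1 fun h => hz h.1)) rfl
  · rw [hcurve s u t ht]
    obtain ⟨lo, hi, -, hsec⟩ := exists_earSection_eq_Icc hp hq u.letter ht
    refine mem_template ht ?_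
    have h1 := L.pos_mem u t ht
    have h2 := D.pos_mem u t ht
    rw [hsec] at h1 h2 ⊢
    exact convex_Icc lo hi h1 h2 (sub_nonneg.2 s.2.2) s.2.1 (by ring)
  · rw [hcurve 1 u t ht, curve, earPoint_eq]
    simp

end TemplateLink

theorem mainTheorem8 {c : ℕ} (W : CodeWords c) (p q : ℝ)
    (hp : (W.kMax : ℝ) + 2 / 5 ≤ p) (hq : (W.lMax : ℝ) + 2 / 5 ≤ q) :
    ∃ σ τ : Fin W.nbar ≃ W.Base,
      -- the ordering procedure succeeds and has exactly one outcome for each full bunch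
      (∀ σ', W.IsXOrder σ' ↔ σ' = σ) ∧ (∀ τ', W.IsYOrder τ' ↔ τ' = τ) ∧
      -- the outcome is the order within the full bunches of the link
      (∀ L : TemplateLink W p q, L.IsFullXBunchOrder σ ∧ L.IsFullYBunchOrder τ) ∧
      -- the points can be marked, and from any marking the link can be drawn, with straight strands
      Nonempty W.Marking ∧
      ∀ P : W.Marking,
        (∃ D : TemplateLink W p q, D.IsDrawnFrom P σ τ ∧ D.IsStraight) ∧
        -- whatever is drawn is the given link
        ∀ D : TemplateLink W p q, D.IsDrawnFrom P σ τ →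
          ∀ L : TemplateLink W p q, L.AmbientIsotopic D := by
  have hp0 : 0 < p := by linarith [Nat.cast_nonneg (α := ℝ) W.kMax]
  have hq0 : 0 < q := by linarith [Nat.cast_nonneg (α := ℝ) W.lMax]
  obtain ⟨σ, hσ⟩ := existsUnique_listing W.card_base W.XBefore (fun _ _ h => h.asymm)
    (fun _ _ _ h h' => h.trans h') fun _ _ h => xBefore_or_xBefore h
  obtain ⟨τ, hτ⟩ := existsUnique_listing W.card_base W.YBefore (fun _ _ h => h.asymm)
    (fun _ _ _ h h' => h.trans h') fun _ _ h => yBefore_or_yBefore h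
  have hσ' : W.IsXOrder σ := (hσ σ).2 rfl
  have hτ' : W.IsYOrder τ := (hτ τ).2 rfl
  exact ⟨σ, τ, hσ, hτ, fun L => ⟨L.isFullXBunchOrder hσ', L.isFullYBunchOrder hτ'⟩,
    Marking.nonempty, fun P => ⟨⟨P.straightLink hσ' hτ' hp hq,
      P.straightLink_isDrawnFrom hσ' hτ' hp hq, P.straightLink_isStraight hσ' hτ' hp hq⟩,
      fun D _ L => L.ambientIsotopic D hp0 hq0⟩⟩
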